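/- Let $\mathbb K$ be an algebraically closed field of characteristic zero, and let $\mathcal P(t)=(p_1(t):p_2(t):p(t))$, with $p_1,p_2,p\in\mathbb K[t]$ and $\gcd(p_1,p_2,p)=1$, be a proper parametrization of a plane curve $\mathcal C\subset\mathbb P^2(\mathbb K)$ that is not a line; that is, $\mathcal C$ is the Zariski closure of $\{\mathcal P(t): t\in\mathbb K\}$ and the map $t\mapsto\mathcal P(t)$ is birational onto $\mathcal C$ (it has degree $1$). Put $d=\max\{\deg p_1,\deg p_2,\deg p\}$ and let $a_d,b_d,c_d$ be the coefficients of $t^d$ in $p_1,p_2,p$. The limit point of $\mathcal P$ is $P_L=(a_d:b_d:c_d)$. For a triple of polynomials $(q_1,q_2,q)$, the fibre function of $P_L$ is $\gcd(a_dq-c_dq_1,\ b_dq-c_dq_2,\ a_dq_2-b_dq_1)$. Let $H_L$ be the fibre function of $P_L$ for $(p_1,p_2,p)$, and let $H_L^{\mathcal U}$ be the fibre function of $P_L$ for the triple $(t^dp_1(1/t),\,t^dp_2(1/t),\,t^dp(1/t))$, which represents $\mathcal U(t)=\mathcal P(1/t)$. The visible multiplicity of $P_L$ is $\deg H_L$,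 and its hidden multiplicity $m_H$ is the exponent of $t$ in $H_L^{\mathcal U}$. If $P_L$ is reached by the parametrization, i.e. $\mathcal P(t_0)=P_L$ for some $t_0\in\mathbb K$, then $P_L$ is a singular point of $\mathcal C$ (a point of multiplicity at least $2$). More precisely, $$\operatorname{mult}_{P_L}(\mathcal C)=\deg H_L+m_H,\qquad \deg H_L\ge 1,\qquad m_H\ge 1 .$$ -/

import Mathlib

open Polynomial
open scoped LinearAlgebra.Projectivization

noncomputable section

/-- The projective plane over `K`. -/
abbrev ProjPlane (K : Type*) [Field K] : Type _ := ℙ K (Fin 3 → K)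

/-- The form `F` vanishes at the point `x` (for homogeneous `F` this does not depend on the
representative of `x`). -/
def VanishesAt {K : Type*} [Field K] (F : MvPolynomial (Fin 3) K) (x : ProjPlane K) : Prop :=
  MvPolynomial.eval x.rep F = 0

/-- The homogeneous forms that vanish on a set of points of the projective plane. -/
def vanishingForms {K : Type*} [Field K] (S : Set (ProjPlane K)) :
    Set (MvPolynomial (Fin 3) K) :=
  {F | (∃ n : ℕ, F.IsHomogeneous n) ∧ ∀ x ∈ S, VanishesAt F x}

/-- The homogeneous ideal of a set of points of the projective plane. -/
def homogeneousIdeal {K : Type*} [Field K] (S : Set (ProjPlane K)) :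
    Ideal (MvPolynomial (Fin 3) K) :=
  Ideal.span (vanishingForms S)

/-- The Zariski closure of a set of points of the projective plane. -/
def projZariskiClosure {K : Type*} [Field K] (S : Set (ProjPlane K)) : Set (ProjPlane K) :=
  {x | ∀ F ∈ vanishingForms S, VanishesAt F x}

/-- `F` is a defining form of the plane curve `C`: a homogeneous generator of the ideal of `C`. -/
def IsDefiningForm {K : Type*} [Field K] (C : Set (ProjPlane K))
    (F : MvPolynomial (Fin 3) K) : Prop :=
  (∃ n : ℕ, F.IsHomogeneous n) ∧ Ideal.span {F} = homogeneousIdeal C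

/-- The order of vanishing of `F` at `x`: the least degree of a nonzero homogeneous component of
`F (v + X)`, where `v` represents `x`. -/
def orderAt {K : Type*} [Field K] (F : MvPolynomial (Fin 3) K) (x : ProjPlane K) : ℕ :=
  sInf {k : ℕ | MvPolynomial.homogeneousComponent k
    (MvPolynomial.aeval
      (fun i : Fin 3 => (MvPolynomial.X i + MvPolynomial.C (x.rep i) : MvPolynomial (Fin 3) K))
      F) ≠ 0}

/-- The multiplicity of the plane curve `C` at `x`: the order of vanishing at `x` of a defining
form of `C`. Defining forms of `C` differ by constant factors, so for a curve the set below has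
exactly one element. -/
def curveMultiplicity {K : Type*} [Field K] (C : Set (ProjPlane K)) (x : ProjPlane K) : ℕ :=
  sInf {m : ℕ | ∃ F, IsDefiningForm C F ∧ orderAt F x = m}

/-- `x` is a singular point of the plane curve `C`: a point of `C` of multiplicity at least 2. -/
def IsSingularPoint {K : Type*} [Field K] (C : Set (ProjPlane K)) (x : ProjPlane K) : Prop :=
  x ∈ C ∧ 2 ≤ curveMultiplicity C x

/-- `C` is a line of the projective plane. -/
def IsProjLine {K : Type*} [Field K] (C : Set (ProjPlane K)) : Prop :=
  ∃ a : Fin 3 → K, a ≠ 0 ∧ C = {x | ∑ i, a i * x.rep i = 0}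

open Classical in
/-- The fibre function of the point with homogeneous coordinates `v = (a, b, c)` with respect to
the triple `p = (p₁, p₂, p₃)`: the gcd (determined up to a constant factor) of
`a p₃ - c p₁`, `b p₃ - c p₂` and `a p₂ - b p₁`. -/
def fibreFunction {K : Type*} [Field K] (p : Fin 3 → K[X]) (v : Fin 3 → K) : K[X] :=
  EuclideanDomain.gcd (C (v 0) * p 2 - C (v 2) * p 0)
    (EuclideanDomain.gcd (C (v 1) * p 2 - C (v 2) * p 1) (C (v 0) * p 1 - C (v 1) * p 0))

/-- A projective polynomial parametrization `(p₁(t) : p₂(t) : p₃(t))` with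
`gcd (p₁, p₂, p₃) = 1`. -/
structure PlaneParametrization (K : Type*) [Field K] where
  /-- The coordinate polynomials. -/
  coords : Fin 3 → K[X]
  gcd_eq_one : ∀ q : K[X], (∀ i, q ∣ coords i) → IsUnit q

namespace PlaneParametrization

variable {K : Type*} [Field K] (P : PlaneParametrization K)

/-- The maximum `d` of the degrees of the coordinate polynomials. -/
def deg : ℕ := Finset.univ.sup fun i => (P.coords i).natDegree

theorem eval_ne_zero (t : K) : (fun i => (P.coords i).eval t) ≠ 0 := by
  intro h
  refine Polynomial.not_isUnit_X_sub_C t (P.gcd_eq_one _ fun i => ?_)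
  exact Polynomial.dvd_iff_isRoot.2 (congrFun h i)

theorem coeff_deg_ne_zero : (fun i => (P.coords i).coeff P.deg) ≠ 0 := by
  intro h
  obtain ⟨i, -, hi⟩ := Finset.exists_mem_eq_sup (Finset.univ : Finset (Fin 3))
    Finset.univ_nonempty fun i => (P.coords i).natDegree
  have h0 : P.coords i = 0 := by
    have := congrFun h i
    simp only [deg, hi, Pi.zero_apply] at this
    exact Polynomial.leadingCoeff_eq_zero.1 this
  have hd : P.deg = 0 := by
    simp only [deg, hi, h0, Polynomial.natDegree_zero]
  refine P.eval_ne_zero 0 (funext fun j => ?_)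
  have := congrFun h j
  rw [hd] at this
  simpa [Polynomial.coeff_zero_eq_eval_zero] using this

/-- The point `𝒫(t)` reached at the parameter value `t`. -/
def point (t : K) : ProjPlane K :=
  Projectivization.mk K (fun i => (P.coords i).eval t) (P.eval_ne_zero t)

/-- The limit point `(a_d : b_d : c_d)`. -/
def limitPoint : ProjPlane K :=
  Projectivization.mk K (fun i => (P.coords i).coeff P.deg) P.coeff_deg_ne_zero

/-- The plane curve defined by the parametrization: the Zariski closure of its image. -/
def curve : Set (ProjPlane K) := projZariskiClosure (Set.range P.point)

/-- The image in `K(t)` of the function field of the curve under pullback along `t ↦ 𝒫(t)`: the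
field generated over `K` by the quotients of the homogeneous coordinates. -/
def functionField : IntermediateField K (RatFunc K) :=
  IntermediateField.adjoin K {f | ∃ i j, P.coords j ≠ 0 ∧
    f = algebraMap K[X] (RatFunc K) (P.coords i) / algebraMap K[X] (RatFunc K) (P.coords j)}

/-- The degree `[K(t) : K(C)]` of the rational map `t ↦ 𝒫(t)` onto the curve (with value `0` when
the extension is infinite, that is, when the parametrization is constant). -/
def mapDegree : ℕ := Module.finrank P.functionField (RatFunc K)

/-- The parametrization is proper, i.e. birational onto the curve. -/
def IsProper : Prop := P.mapDegree = 1

/-- The degree of the fibre function `H_L` of the limit point. -/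
def visibleMultiplicity : ℕ :=
  (fibreFunction P.coords P.limitPoint.rep).natDegree

/-- The coordinates `t ^ d * pᵢ(1 / t)` of the reparametrization `𝒰(t) = 𝒫(1 / t)`. -/
def reversedCoords : Fin 3 → K[X] := fun i => (P.coords i).reflect P.deg

/-- The exponent of `t` in the fibre function of the limit point with respect to
`𝒰(t) = 𝒫(1 / t)`. -/
def hiddenMultiplicity : ℕ :=
  (fibreFunction P.reversedCoords P.limitPoint.rep).rootMultiplicity 0

end PlaneParametrization

end

/-! Let v represent the limit point and let F be a defining form, of degree n. The order of F at v
is n minus the degree in T of F(X + T v) (`orderAt_add_natDegree_shiftAlong`). Take a frame whose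
third vector is v and let q₀, q₁, q₂ be the coordinates of the parametrization in it. Projection
from v is t ↦ (q₀ : q₁). As the parametrization is proper, the T-degree equals [K(t) : K(q₀/q₁)]
(`natDegree_shiftAlong_eq_finrank`), which is max(deg q₀, deg q₁) - deg gcd(q₀, q₁).

This gcd is H_L (`dvd_fibreFunction_iff`), and reversing coefficients gives m_H = d - max(deg q₀,
deg q₁) (`rootMultiplicity_fibreFunction_reversedCoords`). The same projection formula at a point
off the curve yields n = d (`degree_eq_deg`). Combining these, the multiplicity is deg H_L + m_H.
Both summands are positive: t₀ is a common root of q₀ and q₁, and both have degree below d because v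
is the limit point.

Two facts support this. The ideal of the curve is generated by one form (`exists_form_ker_coneHom`),
and the coordinates are linearly independent (`linearIndependent_coords`), because a proper
parametrization of a line has degree 1 and cannot reach its limit point. -/

noncomputable section

/-! ### Homogeneous forms and their order at a point -/

namespace MvPolynomial

/-- Euler scaling for homogeneous forms. -/
theorem aeval_mul_of_isHomogeneous {R A σ : Type*} [CommRing R] [CommRing A] [Algebra R A]
    {F : MvPolynomial σ R} {n : ℕ} (hF : F.IsHomogeneous n) (c : A) (x : σ → A) :
    aeval (fun i => c * x i) F = c ^ n * aeval x F := by
  simp only [aeval_def, eval₂_eq, Finset.mul_sum]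
  refine Finset.sum_congr rfl fun m hm => ?_
  simp only [mul_pow, Finset.prod_mul_distrib, Finset.prod_pow_eq_pow_sum]
  have : ∑ i ∈ m.support, m i = n := by
    simpa [Finsupp.degree] using hF.degree_eq_sum_deg_support hm |>.symm
  rw [this]
  ring

/-- A generator of a homogeneous principal ideal is itself homogeneous. -/
theorem exists_isHomogeneous_of_span_singleton {K σ : Type*} [Field K] {f : MvPolynomial σ K}
    (h : ∀ k, homogeneousComponent k f ∈ Ideal.span {f}) : ∃ n, f.IsHomogeneous n := by
  by_cases hf : f = 0
  · exact ⟨0, hf ▸ isHomogeneous_zero _ _ _⟩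
  obtain ⟨k, hk⟩ : ∃ k, homogeneousComponent k f ≠ 0 := by
    by_contra! hcon
    apply hf
    rw [← sum_homogeneousComponent f]
    exact Finset.sum_eq_zero fun i _ => hcon i
  obtain ⟨u, hu⟩ := Ideal.mem_span_singleton.1 (h k)
  have hu0 : u ≠ 0 := by rintro rfl; exact hk (by simpa using hu)
  have hdeg := totalDegree_mul_of_isDomain hf hu0
  have hhom := homogeneousComponent_isHomogeneous k f
  have hk' : k ≤ f.totalDegree := by
    by_contra! hlt
    exact hk (homogeneousComponent_eq_zero _ _ hlt)
  -- The degrees give k = deg f + deg u with k ≤ deg f, so the cofactor u is constant.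
  rw [← hu, hhom.totalDegree hk] at hdeg
  obtain ⟨c, rfl⟩ : ∃ c, u = C c := ⟨_, totalDegree_eq_zero_iff_eq_C.1 (by omega)⟩
  have hc : c ≠ 0 := by rintro rfl; simp at hu0
  refine ⟨k, ?_⟩
  have : f = C c⁻¹ * homogeneousComponent k f := by
    rw [hu, mul_comm f, ← mul_assoc, ← C_mul, inv_mul_cancel₀ hc, C_1, one_mul]
  rw [this]
  exact hhom.C_mul _

/-- The polynomial `F (X + T v)` in the variable `T`. -/
def shiftAlong {K σ : Type*} [Field K] (F : MvPolynomial σ K) (v : σ → K) : (MvPolynomial σ K)[X] :=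
  aeval (fun i => Polynomial.C (X i) + Polynomial.C (C (v i)) * Polynomial.X) F

theorem shiftAlong_eq_finSuccEquiv {K : Type*} [Field K] {N : ℕ} (F : MvPolynomial (Fin N) K)
    (v : Fin N → K) :
    shiftAlong F v = finSuccEquiv K N (aeval (fun i => X i.succ + C (v i) * X 0) F) := by
  rw [shiftAlong, ← AlgEquiv.coe_toAlgHom, ← AlgHom.comp_apply, comp_aeval]
  congr 2
  funext i
  have hC : finSuccEquiv K N (C (v i)) = Polynomial.C (C (v i)) := by
    rw [← algebraMap_eq, AlgEquiv.commutes]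
    rfl
  simp [finSuccEquiv_X_zero, finSuccEquiv_X_succ, hC]

theorem IsHomogeneous.shiftAlong_coeff {K : Type*} [Field K] {N n : ℕ}
    {F : MvPolynomial (Fin N) K} (hF : F.IsHomogeneous n) (v : Fin N → K) (i j : ℕ)
    (h : i + j = n) : ((shiftAlong F v).coeff i).IsHomogeneous j := by
  rw [shiftAlong_eq_finSuccEquiv]
  refine IsHomogeneous.finSuccEquiv_coeff_isHomogeneous ?_ i j h
  have := hF.aeval (n := 1) (fun i : Fin N => (X i.succ + C (v i) * X 0 : MvPolynomial (Fin (N+1)) K))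
    fun i => (isHomogeneous_X _ _).add (isHomogeneous_C_mul_X _ _)
  simpa using this

theorem IsHomogeneous.natDegree_shiftAlong_le {K : Type*} [Field K] {N n : ℕ}
    {F : MvPolynomial (Fin N) K} (hF : F.IsHomogeneous n) (v : Fin N → K) :
    (shiftAlong F v).natDegree ≤ n := by
  rw [shiftAlong_eq_finSuccEquiv, natDegree_finSuccEquiv]
  refine (degreeOf_le_totalDegree _ _).trans ?_
  have := hF.aeval (n := 1) (fun i : Fin N => (X i.succ + C (v i) * X 0 : MvPolynomial (Fin (N+1)) K))
    fun i => (isHomogeneous_X _ _).add (isHomogeneous_C_mul_X _ _)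
  simpa using this.totalDegree_le

theorem aeval_shiftAlong {K σ A : Type*} [Field K] [CommRing A] [Algebra K A]
    (F : MvPolynomial σ K) (v : σ → K) (x : σ → A) (t : A) :
    (shiftAlong F v).eval₂ (aeval x : MvPolynomial σ K →ₐ[K] A).toRingHom t =
      aeval (fun i => x i + algebraMap K A (v i) * t) F := by
  induction F using MvPolynomial.induction_on with
  | C a => simp [shiftAlong, Polynomial.eval₂_C]
  | add p q hp hq => simp only [shiftAlong, map_add, Polynomial.eval₂_add] at *; rw [hp, hq]
  | mul_X p i hp =>
    simp only [shiftAlong, map_mul, Polynomial.eval₂_mul] at *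
    rw [hp]
    simp

theorem shiftAlong_ne_zero {K σ : Type*} [Field K] {F : MvPolynomial σ K} (hF : F ≠ 0)
    (v : σ → K) : shiftAlong F v ≠ 0 := by
  intro h
  have := aeval_shiftAlong F v (X : σ → MvPolynomial σ K) 0
  rw [h] at this
  simp at this
  exact hF this.symm

theorem shiftAlong_mul {K σ : Type*} [Field K] (F G : MvPolynomial σ K)
    (v : σ → K) : shiftAlong (F * G) v = shiftAlong F v * shiftAlong G v := by
  simp [shiftAlong]

end MvPolynomial

open MvPolynomial in
/-- The order of a form of degree `n` at `x` is `n` minus its degree in the direction of `x`. -/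
theorem orderAt_add_natDegree_shiftAlong {K : Type*} [Field K] {n : ℕ}
    {F : MvPolynomial (Fin 3) K} (hF : F.IsHomogeneous n) (h0 : F ≠ 0) (x : ProjPlane K) :
    orderAt F x + (shiftAlong F x.rep).natDegree = n := by
  set S := shiftAlong F x.rep with hS
  have hle : S.natDegree ≤ n := hF.natDegree_shiftAlong_le _
  -- Set T = 1. The coefficient of T^j is homogeneous of degree n - j, so the coefficients are the
  -- homogeneous components of F(X + v) and the lowest one is the leading coefficient in T.
  have hsum : aeval (fun i : Fin 3 => (X i + MvPolynomial.C (x.rep i) : MvPolynomial (Fin 3) K)) F =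
      ∑ j ∈ Finset.range (n + 1), S.coeff j := by
    have h1 := aeval_shiftAlong F x.rep (X : Fin 3 → MvPolynomial (Fin 3) K) 1
    rw [Polynomial.eval₂_eq_sum_range' _ (Nat.lt_succ_of_le hle)] at h1
    simpa using h1.symm
  have hcomp : ∀ k, homogeneousComponent k
      (aeval (fun i : Fin 3 => (X i + MvPolynomial.C (x.rep i) : MvPolynomial (Fin 3) K)) F) =
      if k ≤ n then S.coeff (n - k) else 0 := by
    intro k
    rw [hsum, map_sum]
    have : ∀ j ∈ Finset.range (n + 1), homogeneousComponent k (S.coeff j) =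
        if n - j = k then S.coeff j else 0 := by
      intro j hj
      have hjn : j ≤ n := Nat.lt_succ_iff.1 (Finset.mem_range.1 hj)
      simpa [eq_comm] using homogeneousComponent_of_mem (m := k)
        (hF.shiftAlong_coeff x.rep j (n - j) (by omega))
    rw [Finset.sum_congr rfl this]
    split_ifs with hk
    · rw [Finset.sum_eq_single (n - k)]
      · rw [if_pos (by omega)]
      · intro j hj hne
        have := Finset.mem_range.1 hj
        rw [if_neg (by omega)]
      · intro h
        exact absurd (Finset.mem_range.2 (by omega)) h
    · refine Finset.sum_eq_zero fun j hj => if_neg (by omega)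
  have hord : orderAt F x = n - S.natDegree := by
    unfold orderAt
    simp only [hcomp]
    refine le_antisymm (Nat.sInf_le ?_) (le_csInf ⟨n - S.natDegree, ?_⟩ ?_)
    iterate 2
      rw [Set.mem_ofPred_eq, if_pos (by omega), Nat.sub_sub_self hle]
      exact Polynomial.leadingCoeff_ne_zero.2 (shiftAlong_ne_zero h0 _)
    intro k hk
    rw [Set.mem_ofPred_eq] at hk
    split_ifs at hk with hkn
    · have := Polynomial.le_natDegree_of_ne_zero hk
      omega
    · exact absurd rfl hk
  omega

/-! ### The T-degree of a form as the degree of a projection -/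

open scoped IntermediateField

/-- The linear form with coefficients `a`. -/
def linearForm {K : Type*} [Field K] (a : Fin 3 → K) : MvPolynomial (Fin 3) K :=
  ∑ k, MvPolynomial.C (a k) * MvPolynomial.X k

theorem isHomogeneous_linearForm {K : Type*} [Field K] (a : Fin 3 → K) :
    (linearForm a).IsHomogeneous 1 :=
  MvPolynomial.IsHomogeneous.sum _ _ _ fun _ _ => MvPolynomial.isHomogeneous_C_mul_X _ _

theorem aeval_linearForm {K A : Type*} [Field K] [CommRing A] [Algebra K A] (a : Fin 3 → K)
    (x : Fin 3 → A) : MvPolynomial.aeval x (linearForm a) = ∑ k, algebraMap K A (a k) * x k := by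
  simp [linearForm]

theorem sum_matrix_mul_eq {K A : Type*} [Field K] [CommRing A] [Algebra K A]
    {M N : Matrix (Fin 3) (Fin 3) K} (hMN : M * N = 1) (x : Fin 3 → A) (i : Fin 3) :
    ∑ j, algebraMap K A (M i j) * ∑ k, algebraMap K A (N j k) * x k = x i := by
  simp_rw [Finset.mul_sum]
  rw [Finset.sum_comm]
  have : ∀ k, ∑ j, algebraMap K A (M i j) * (algebraMap K A (N j k) * x k) =
      algebraMap K A ((1 : Matrix (Fin 3) (Fin 3) K) i k) * x k := by
    intro k
    rw [← hMN, Matrix.mul_apply, map_sum, Finset.sum_mul]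
    exact Finset.sum_congr rfl fun j _ => by rw [map_mul, mul_assoc]
  simp [this, Matrix.one_apply]

/-- With s transcendental and X free, the point with frame coordinates (s, 1, X) is generic in the
plane. If F vanished there, it would vanish at every point whose second frame coordinate is nonzero.
-/
theorem aeval_affine_ne_zero {K E : Type*} [Field K] [Infinite K] [Field E] [Algebra K E]
    {M N : Matrix (Fin 3) (Fin 3) K} (hMN : M * N = 1) {s : E} (hs : Transcendental K s)
    {n : ℕ} {F : MvPolynomial (Fin 3) K} (hF : F.IsHomogeneous n) (h0 : F ≠ 0) :
    MvPolynomial.aeval (fun i => Polynomial.C (s * algebraMap K E (M i 0) + algebraMap K E (M i 1)) +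
      Polynomial.C (algebraMap K E (M i 2)) * X : Fin 3 → E[X]) F ≠ 0 := by
  intro h
  set Q : K[X][X] := MvPolynomial.aeval
    (fun i => Polynomial.C (X * C (M i 0) + C (M i 1)) + Polynomial.C (C (M i 2)) * X) F with hQ
  have hmap : Polynomial.mapAlgHom (aeval s : K[X] →ₐ[K] E) Q = 0 := by
    rw [hQ, ← AlgHom.comp_apply, MvPolynomial.comp_aeval, ← h]
    congr 2
    funext i
    simp
    exact mul_comm _ _
  have hinj : Function.Injective (aeval s : K[X] →ₐ[K] E) := transcendental_iff_injective.1 hs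
  have hQ0 : Q = 0 := by
    have : Polynomial.map (aeval s : K[X] →ₐ[K] E).toRingHom Q = 0 := by simpa using hmap
    exact (Polynomial.map_eq_zero_iff hinj).1 this
  have hval : ∀ a c : K, MvPolynomial.aeval (fun i => a * M i 0 + M i 1 + M i 2 * c) F = 0 := by
    intro a c
    have h1 : ((Polynomial.aeval a : K[X] →ₐ[K] K).comp
        ((Polynomial.aeval (Polynomial.C c) : K[X][X] →ₐ[K[X]] K[X]).restrictScalars K)) Q = 0 := by
      rw [hQ0, map_zero]
    rw [hQ, ← AlgHom.comp_apply, MvPolynomial.comp_aeval] at h1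
    rw [← h1]
    congr 2
    funext i
    simp
    exact mul_comm _ _
  -- The factor absorbs the line where the second frame coordinate is zero, on which `hval` says
  -- nothing. It is a nonzero form, since it takes the value 1 at column 1 of M.
  have hmul : F * linearForm (N 1) = 0 := by
    refine MvPolynomial.funext fun r => ?_
    rw [map_mul, map_zero]
    by_cases hb : MvPolynomial.eval r (linearForm (N 1)) = 0
    · rw [hb, mul_zero]
    have hlin : ∀ j, MvPolynomial.eval r (linearForm (N j)) = ∑ k, N j k * r k := fun j => by
      simp [linearForm]
    set b := MvPolynomial.eval r (linearForm (N 1)) with hbdef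
    have hr : r = fun i => b * ((∑ k, N 0 k * r k) / b * M i 0 + M i 1 +
        M i 2 * ((∑ k, N 2 k * r k) / b)) := by
      funext i
      have := sum_matrix_mul_eq hMN r i
      simp only [Algebra.algebraMap_self, RingHom.id_apply] at this
      rw [← this, Fin.sum_univ_three]
      rw [← hlin 1, ← hbdef]
      field_simp
    have h2 : MvPolynomial.aeval r F = 0 := by
      rw [hr, MvPolynomial.aeval_mul_of_isHomogeneous hF, hval, mul_zero]
    rw [MvPolynomial.aeval_eq_eval] at h2
    rw [h2, zero_mul]
  rcases mul_eq_zero.1 hmul with h1 | h1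
  · exact h0 h1
  · have h2 := aeval_linearForm (N 1) (fun k => M k 1)
    have h3 : (N * M) 1 1 = 1 := by rw [mul_eq_one_comm.1 hMN]; simp
    rw [h1, map_zero] at h2
    rw [Matrix.mul_apply] at h3
    simp [h3] at h2

open scoped IntermediateField.algebraAdjoinAdjoin in
/-- Clearing denominators in the minimal polynomial over a simple transcendental extension. -/
theorem exists_bivariate_relation {K L : Type*} [Field K] [Field L] [Algebra K L] {s z : L}
    (hs : Transcendental K s) (hz : IsIntegral K⟮s⟯ z) :
    ∃ g : K[X][X], g ≠ 0 ∧ g.natDegree ≤ (minpoly K⟮s⟯ z).natDegree ∧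
      g.eval₂ (aeval s : K[X] →ₐ[K] L).toRingHom z = 0 := by
  set m := minpoly K⟮s⟯ z
  let A := Algebra.adjoin K {s}
  let e := Polynomial.algEquivOfTranscendental K s hs
  let g' : A[X] := IsLocalization.integerNormalization (nonZeroDivisors A) m
  have hg0 : g' ≠ 0 := by
    rw [Ne, IsFractionRing.integerNormalization_eq_zero_iff]
    exact minpoly.ne_zero hz
  refine ⟨g'.map e.symm.toRingEquiv.toRingHom, ?_, ?_, ?_⟩
  · rw [Ne, Polynomial.map_eq_zero_iff]
    exacts [hg0, e.symm.injective]
  · refine Polynomial.natDegree_map_le.trans ?_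
    exact Polynomial.natDegree_le_natDegree (Polynomial.degree_mono <|
      IsLocalization.integerNormalization_support _ _)
  · rw [Polynomial.eval₂_map]
    have h1 : aeval z g' = 0 :=
      IsLocalization.integerNormalization_aeval_eq_zero _ _ (minpoly.aeval _ _)
    rw [aeval_def] at h1
    rw [← h1]
    congr 1
    ext a
    obtain ⟨b, rfl⟩ := e.surjective a
    simp [e]

theorem sum_mul_matrix_eq {K A : Type*} [Field K] [CommRing A] [Algebra K A]
    {M N : Matrix (Fin 3) (Fin 3) K} (hNM : N * M = 1) (s z : A) (j : Fin 3) :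
    ∑ k, algebraMap K A (N j k) *
      (s * algebraMap K A (M k 0) + algebraMap K A (M k 1) + algebraMap K A (M k 2) * z) =
      ![s, 1, z] j := by
  have h : ∀ l, ∑ k, algebraMap K A (N j k) * algebraMap K A (M k l) =
      algebraMap K A ((1 : Matrix (Fin 3) (Fin 3) K) j l) := fun l => by
    rw [← hNM, Matrix.mul_apply, map_sum]
    exact Finset.sum_congr rfl fun _ _ => (map_mul _ _ _).symm
  have h0 := h 0
  have h1 := h 1
  have h2 := h 2
  rw [Fin.sum_univ_three] at *
  have : ![s, 1, z] j = s * algebraMap K A ((1 : Matrix (Fin 3) (Fin 3) K) j 0) +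
      algebraMap K A ((1 : Matrix (Fin 3) (Fin 3) K) j 1) +
      algebraMap K A ((1 : Matrix (Fin 3) (Fin 3) K) j 2) * z := by
    match j with
    | 0 => simp
    | 1 => simp
    | 2 => simp
  rw [this, ← h0, ← h1, ← h2]
  ring

theorem shiftAlong_linearForm {K : Type*} [Field K] (a v : Fin 3 → K) :
    MvPolynomial.shiftAlong (linearForm a) v =
      C (linearForm a) + C (MvPolynomial.C (∑ k, a k * v k)) * X := by
  have hC : ∀ r : K, algebraMap K (MvPolynomial (Fin 3) K)[X] r = C (MvPolynomial.C r) :=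
    fun r => rfl
  rw [MvPolynomial.shiftAlong, aeval_linearForm]
  simp only [hC, linearForm, map_sum, map_mul, Finset.sum_mul, ← Finset.sum_add_distrib]
  exact Finset.sum_congr rfl fun k _ => by ring

universe u in
/-- Homogenization of a bivariate polynomial in the linear coordinates given by the rows of `N`. -/
theorem exists_homogenization {K : Type u} [Field K] {M N : Matrix (Fin 3) (Fin 3) K}
    (hNM : N * M = 1) {g : K[X][X]} (hg : g ≠ 0) :
    ∃ (n : ℕ) (G : MvPolynomial (Fin 3) K), G.IsHomogeneous n ∧ G ≠ 0 ∧
      (MvPolynomial.shiftAlong G fun i => M i 2).natDegree ≤ g.natDegree ∧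
      ∀ {A : Type u} [CommRing A] [Algebra K A] (s z : A),
        MvPolynomial.aeval (fun i =>
          s * algebraMap K A (M i 0) + algebraMap K A (M i 1) + algebraMap K A (M i 2) * z) G =
        g.eval₂ (aeval s : K[X] →ₐ[K] A).toRingHom z := by
  set e := g.natDegree with he
  obtain ⟨D, hD⟩ : ∃ D, ∀ j, (g.coeff j).natDegree ≤ D := by
    refine ⟨g.support.sup fun j => (g.coeff j).natDegree, fun j => ?_⟩
    by_cases hj : j ∈ g.support
    · exact Finset.le_sup (f := fun j => (g.coeff j).natDegree) hj
    · simp [Polynomial.notMem_support_iff.1 hj]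
  -- The second linear form takes the value 1 at the points considered, so its exponent is free to
  -- pad every term to degree D + e.
  let G : MvPolynomial (Fin 3) K := ∑ j ∈ Finset.range (e + 1), ∑ i ∈ Finset.range (D + 1),
    MvPolynomial.C ((g.coeff j).coeff i) *
      (linearForm (N 0) ^ i * linearForm (N 1) ^ (D - i + (e - j)) * linearForm (N 2) ^ j)
  have hval : ∀ {A : Type u} [CommRing A] [Algebra K A] (s z : A),
      MvPolynomial.aeval (fun i =>
        s * algebraMap K A (M i 0) + algebraMap K A (M i 1) + algebraMap K A (M i 2) * z) G =
      g.eval₂ (aeval s : K[X] →ₐ[K] A).toRingHom z := by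
    intro A _ _ s z
    simp only [G, map_sum, map_mul, map_pow, aeval_linearForm, sum_mul_matrix_eq hNM]
    rw [Polynomial.eval₂_eq_sum_range' _ (Nat.lt_succ_self _)]
    refine Finset.sum_congr rfl fun j _ => ?_
    have : (aeval s : K[X] →ₐ[K] A).toRingHom (g.coeff j) =
        ∑ i ∈ Finset.range (D + 1), algebraMap K A ((g.coeff j).coeff i) * s ^ i := by
      change aeval s (g.coeff j) = _
      rw [aeval_def, Polynomial.eval₂_eq_sum_range' _ (Nat.lt_succ_of_le (hD j))]
    rw [this, Finset.sum_mul]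
    refine Finset.sum_congr rfl fun i _ => ?_
    simp [mul_assoc]
  refine ⟨D + e, G, ?_, ?_, ?_, hval⟩
  · refine MvPolynomial.IsHomogeneous.sum _ _ _ fun j hj =>
      MvPolynomial.IsHomogeneous.sum _ _ _ fun i hi => ?_
    have hi' := Finset.mem_range.1 hi
    have hj' := Finset.mem_range.1 hj
    have := (((isHomogeneous_linearForm (N 0)).pow i).mul
      ((isHomogeneous_linearForm (N 1)).pow (D - i + (e - j)))).mul
        ((isHomogeneous_linearForm (N 2)).pow j)
    rw [show D + e = 1 * i + 1 * (D - i + (e - j)) + 1 * j by omega]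
    exact this.C_mul _
  · intro hG
    apply hg
    -- Evaluation at the universal pair of values returns g itself.
    have h1 := hval (A := K[X][X]) (C X) X
    rw [hG, map_zero] at h1
    have h2 : (aeval (C X) : K[X] →ₐ[K] K[X][X]).toRingHom = C := by
      ext <;> simp
    rw [h2, Polynomial.eval₂_C_X] at h1
    exact h1.symm
  -- Rows 0 and 1 of N annihilate the direction M · 2, so T enters only through the third linear
  -- form, whose exponent is at most e.
  · have hrow : ∀ j, ∑ k, N j k * M k 2 = (1 : Matrix (Fin 3) (Fin 3) K) j 2 := fun j => by
      rw [← hNM, Matrix.mul_apply]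
    have hC : ∀ r : K, MvPolynomial.shiftAlong (MvPolynomial.C r) (fun i => M i 2) =
        C (MvPolynomial.C r) := fun r => by simp [MvPolynomial.shiftAlong]
    have hs : MvPolynomial.shiftAlong G (fun i => M i 2) =
        ∑ j ∈ Finset.range (e + 1), ∑ i ∈ Finset.range (D + 1),
          C (MvPolynomial.C ((g.coeff j).coeff i) *
            (linearForm (N 0) ^ i * linearForm (N 1) ^ (D - i + (e - j)))) *
          (C (linearForm (N 2)) + X) ^ j := by
      have hL := fun j => shiftAlong_linearForm (N j) fun i => M i 2
      simp only [MvPolynomial.shiftAlong, G, map_sum, map_mul, map_pow, hrow] at hC hL ⊢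
      simp [hC, hL, mul_assoc]
    rw [hs]
    refine Polynomial.natDegree_sum_le_of_forall_le _ _ fun j hj =>
      Polynomial.natDegree_sum_le_of_forall_le _ _ fun i _ => ?_
    refine (Polynomial.natDegree_C_mul_le _ _).trans ?_
    refine (Polynomial.natDegree_pow_le (n := j)).trans ?_
    rw [add_comm, Polynomial.natDegree_X_add_C]
    have := Finset.mem_range.1 hj
    omega

universe u in
/-- The degree of a defining form in the direction of a point is the degree of the extension of
function fields given by the projection from that point. -/
theorem natDegree_shiftAlong_eq_finrank {K L : Type u} [Field K] [Infinite K] [Field L]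
    [Algebra K L] {M N : Matrix (Fin 3) (Fin 3) K} (hMN : M * N = 1) {s z β : L}
    (hs : Transcendental K s) (hfin : FiniteDimensional K⟮s⟯ L)
    (htop : ∀ E : IntermediateField K L, s ∈ E → z ∈ E → E = ⊤)
    {n : ℕ} {F : MvPolynomial (Fin 3) K} (hF : F.IsHomogeneous n) (h0 : F ≠ 0)
    (hβ : β ≠ 0)
    (hroot : MvPolynomial.aeval (fun i => β * (s * algebraMap K L (M i 0) +
      algebraMap K L (M i 1) + algebraMap K L (M i 2) * z)) F = 0)
    (hdvd : ∀ k (G : MvPolynomial (Fin 3) K), G.IsHomogeneous k →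
      MvPolynomial.aeval (fun i => β * (s * algebraMap K L (M i 0) +
      algebraMap K L (M i 1) + algebraMap K L (M i 2) * z)) G = 0 → F ∣ G) :
    (MvPolynomial.shiftAlong F fun i => M i 2).natDegree = Module.finrank K⟮s⟯ L := by
  have hz : IsIntegral K⟮s⟯ z := IsIntegral.of_finite _ _
  have hrank : Module.finrank K⟮s⟯ L = (minpoly K⟮s⟯ z).natDegree := by
    have ht : K⟮s⟯⟮z⟯ = ⊤ := by
      rw [← IntermediateField.restrictScalars_eq_top_iff (K := K)]
      refine htop _ ?_ ?_
      · exact (K⟮s⟯⟮z⟯).algebraMap_mem (IntermediateField.AdjoinSimple.gen K s)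
      · exact IntermediateField.mem_adjoin_simple_self K⟮s⟯ z
    rw [← IntermediateField.adjoin.finrank hz, ht, IntermediateField.finrank_top']
  rw [hrank]
  rw [MvPolynomial.aeval_mul_of_isHomogeneous hF, mul_eq_zero,
    or_iff_right (pow_ne_zero _ hβ)] at hroot
  refine le_antisymm ?_ ?_
  -- Upper bound: homogenizing the minimal polynomial of z over K(s) gives a form vanishing at the
  -- generic point of the curve. F divides it, and T-degrees are additive.
  · obtain ⟨g, hg0, hgdeg, hgroot⟩ := exists_bivariate_relation hs hz
    obtain ⟨k, G, hG, hG0, hGdeg, hGval⟩ := exists_homogenization (mul_eq_one_comm.1 hMN) hg0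
    obtain ⟨H, rfl⟩ := hdvd k G hG (by
      rw [MvPolynomial.aeval_mul_of_isHomogeneous hG, hGval, hgroot, mul_zero])
    refine le_trans ?_ (hGdeg.trans hgdeg)
    rw [MvPolynomial.shiftAlong_mul]
    refine Polynomial.natDegree_le_of_dvd (dvd_mul_right _ _) (mul_ne_zero ?_ ?_)
    exacts [MvPolynomial.shiftAlong_ne_zero h0 _,
      MvPolynomial.shiftAlong_ne_zero (right_ne_zero_of_mul hG0) _]
  -- Lower bound: F at frame coordinates (s, 1, X) is a nonzero polynomial over K(s) with root z,
  -- hence a multiple of the minimal polynomial. It is a specialization of F(X + T v), so its degree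
  -- is at most the T-degree.
  · set σ : K⟮s⟯ := IntermediateField.AdjoinSimple.gen K s with hσ
    have hσt : Transcendental K σ := by
      rw [← transcendental_algebraMap_iff (R := K) (S := K⟮s⟯) (A := L)
        (FaithfulSMul.algebraMap_injective _ _)]
      exact hs
    have hR0 := aeval_affine_ne_zero hMN hσt hF h0
    set R : K⟮s⟯[X] := MvPolynomial.aeval (fun i =>
      Polynomial.C (σ * algebraMap K _ (M i 0) + algebraMap K _ (M i 1)) +
      Polynomial.C (algebraMap K _ (M i 2)) * X) F with hR
    have hRroot : (aeval z : K⟮s⟯[X] →ₐ[K⟮s⟯] L) R = 0 := by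
      rw [← hroot, hR]
      have := MvPolynomial.comp_aeval (R := K) (fun i =>
        Polynomial.C (σ * algebraMap K K⟮s⟯ (M i 0) + algebraMap K K⟮s⟯ (M i 1)) +
        Polynomial.C (algebraMap K K⟮s⟯ (M i 2)) * X)
        ((aeval z : K⟮s⟯[X] →ₐ[K⟮s⟯] L).restrictScalars K)
      refine (congrArg (fun f => f F) this).trans ?_
      congr 2
      funext i
      simp [hσ]
    refine (Polynomial.natDegree_le_of_dvd (minpoly.dvd _ _ hRroot) hR0).trans ?_
    have hRS : R = (MvPolynomial.shiftAlong F fun i => M i 2).map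
        (MvPolynomial.aeval fun i => σ * algebraMap K _ (M i 0) + algebraMap K _ (M i 1) :
          MvPolynomial (Fin 3) K →ₐ[K] K⟮s⟯).toRingHom := by
      have h1 := MvPolynomial.aeval_shiftAlong F (fun i => M i 2)
        (fun i => (Polynomial.C (σ * algebraMap K K⟮s⟯ (M i 0) + algebraMap K K⟮s⟯ (M i 1))))
        (X : K⟮s⟯[X])
      refine Eq.trans h1.symm ?_
      rw [Polynomial.map]
      congr 1
      ext
      · simp [Polynomial.algebraMap_apply]
      · simp
    rw [hRS]
    exact Polynomial.natDegree_map_le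

/-! ### The ideal of relations is generated by one form -/

/-- The polynomials over a UFD that vanish at an element of an extension field are the multiples
of a single polynomial. -/
theorem exists_aeval_eq_zero_iff_dvd {A L : Type*} [CommRing A] [IsDomain A]
    [UniqueFactorizationMonoid A] [Field L] [Algebra A L] [FaithfulSMul A L] (x : L) :
    ∃ f : A[X], ∀ g, aeval x g = 0 ↔ f ∣ g := by
  let I : Ideal A[X] := RingHom.ker (aeval (R := A) x)
  have hI : I.IsPrime := RingHom.ker_isPrime _
  have hmem : ∀ g, g ∈ I ↔ aeval x g = 0 := fun g => RingHom.mem_ker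
  by_cases hbot : I = ⊥
  · exact ⟨0, fun g => by rw [← hmem, hbot, Ideal.mem_bot, zero_dvd_iff]⟩
  -- A prime element of the kernel cannot be constant, so it is primitive. By Gauss's lemma it stays
  -- irreducible over the fraction field, where it is associated to the minimal polynomial of x.
  obtain ⟨f, hf, hprime⟩ := hI.exists_mem_prime_of_ne_bot hbot
  rw [hmem] at hf
  refine ⟨f, fun g => ⟨fun hg => ?_, fun ⟨q, hq⟩ => by rw [hq, map_mul, hf, zero_mul]⟩⟩
  have hdeg : f.natDegree ≠ 0 := by
    intro h
    obtain ⟨a, rfl⟩ := Polynomial.natDegree_eq_zero.1 h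
    rw [aeval_C, map_eq_zero_iff _ (FaithfulSMul.algebraMap_injective A L)] at hf
    exact hprime.ne_zero (by rw [hf, map_zero])
  have hprim := hprime.irreducible.isPrimitive hdeg
  let Q := FractionRing A
  let _ : Algebra Q L := FractionRing.liftAlgebra A L
  have : IsScalarTower A Q L := FractionRing.isScalarTower_liftAlgebra A L
  obtain ⟨_⟩ : Nonempty (NormalizedGCDMonoid A) := inferInstance
  have hirr := (hprim.irreducible_iff_irreducible_map_fraction_map (K := Q)).1 hprime.irreducible
  rw [hprim.dvd_iff_fraction_map_dvd_fraction_map (K := Q)]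
  have hroot : aeval x (f.map (algebraMap A Q)) = 0 := by rw [aeval_map_algebraMap, hf]
  have hint : IsIntegral Q x := IsAlgebraic.isIntegral ⟨_, hirr.ne_zero, hroot⟩
  have hg' := minpoly.dvd Q x (p := g.map (algebraMap A Q)) (by rw [aeval_map_algebraMap, hg])
  exact ((minpoly.irreducible hint).associated_of_dvd hirr
    (minpoly.dvd Q x hroot)).symm.dvd.trans hg'

/-- Inside the fraction field of B, φ is evaluation at φ(X), and `hinj` makes that field an
extension of A. -/
theorem exists_map_eq_zero_iff_dvd {A B : Type*} [CommRing A] [IsDomain A]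
    [UniqueFactorizationMonoid A] [CommRing B] [IsDomain B] (φ : A[X] →+* B)
    (hinj : ∀ a, φ (C a) = 0 → a = 0) : ∃ f, ∀ g, φ g = 0 ↔ f ∣ g := by
  let L := FractionRing B
  have hBL : Function.Injective (algebraMap B L) := IsFractionRing.injective B L
  let ι : A →+* L := (algebraMap B L).comp (φ.comp C)
  have hι : Function.Injective ι := by
    rw [injective_iff_map_eq_zero]
    exact fun a ha => hinj a ((map_eq_zero_iff _ hBL).1 ha)
  let _ : Algebra A L := ι.toAlgebra
  have : FaithfulSMul A L := (faithfulSMul_iff_algebraMap_injective A L).2 hι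
  obtain ⟨f, hf⟩ := exists_aeval_eq_zero_iff_dvd (A := A) (algebraMap B L (φ X))
  refine ⟨f, fun g => ?_⟩
  rw [← hf, ← map_eq_zero_iff _ hBL]
  have h : Polynomial.eval₂RingHom ι (algebraMap B L (φ X)) = (algebraMap B L).comp φ := by
    ext <;> simp [ι]
  exact Eq.congr_left (congrArg (fun r => r g) h.symm)

/-- The homomorphism of homogeneous coordinate rings `xᵢ ↦ pᵢ(t) w`. -/
def coneHom {K : Type*} [Field K] (p : Fin 3 → K[X]) : MvPolynomial (Fin 3) K →ₐ[K] K[X][X] :=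
  MvPolynomial.aeval fun i => X * C (p i)

theorem coneHom_of_isHomogeneous {K : Type*} [Field K] (p : Fin 3 → K[X]) {n : ℕ}
    {G : MvPolynomial (Fin 3) K} (hG : G.IsHomogeneous n) :
    coneHom p G = X ^ n * C (MvPolynomial.aeval p G) := by
  rw [coneHom, MvPolynomial.aeval_mul_of_isHomogeneous hG]
  congr 1
  have : (Polynomial.CAlgHom (R := K) (A := K[X])) (MvPolynomial.aeval p G) =
      MvPolynomial.aeval (fun i => C (p i)) G := by
    rw [← AlgHom.comp_apply, MvPolynomial.comp_aeval]
    rfl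
  exact this.symm

/-- The powers of w keep the homogeneous components apart. Without w, components of different
degrees could cancel and the kernel need not be homogeneous. -/
theorem mem_ker_coneHom_iff {K : Type*} [Field K] (p : Fin 3 → K[X])
    (G : MvPolynomial (Fin 3) K) : G ∈ RingHom.ker (coneHom p) ↔
      ∀ k, MvPolynomial.aeval p (MvPolynomial.homogeneousComponent k G) = 0 := by
  rw [RingHom.mem_ker]
  have hsum : coneHom p G = ∑ k ∈ Finset.range (G.totalDegree + 1),
      X ^ k * C (MvPolynomial.aeval p (MvPolynomial.homogeneousComponent k G)) := by
    conv_lhs => rw [← MvPolynomial.sum_homogeneousComponent G, map_sum]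
    exact Finset.sum_congr rfl fun k _ =>
      coneHom_of_isHomogeneous p (MvPolynomial.homogeneousComponent_isHomogeneous k G)
  constructor
  · intro h k
    by_cases hk : G.totalDegree < k
    · rw [MvPolynomial.homogeneousComponent_eq_zero _ _ hk, map_zero]
    · have h1 := congrArg (fun q => Polynomial.coeff q k) (hsum.symm.trans h)
      simp only [Polynomial.finsetSum_coeff, Polynomial.coeff_mul_C, Polynomial.coeff_X_pow,
        Polynomial.coeff_zero] at h1
      simpa [Nat.lt_succ_iff, not_lt.1 hk] using h1
  · intro h
    rw [hsum]
    exact Finset.sum_eq_zero fun k _ => by rw [h, map_zero, mul_zero]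

theorem ne_zero_and_transcendental_div {K : Type*} [Field K] {α β : K[X]}
    (h : ∀ a b : K, C a * α + C b * β = 0 → a = 0 ∧ b = 0) :
    β ≠ 0 ∧ Transcendental K (algebraMap K[X] (RatFunc K) α / algebraMap K[X] (RatFunc K) β) := by
  have hβ : β ≠ 0 := by
    rintro rfl
    exact one_ne_zero (h 0 1 (by simp)).2
  refine ⟨hβ, RatFunc.transcendental_of_ne_C _ ?_⟩
  rintro ⟨c, hc⟩
  have hβ' : algebraMap K[X] (RatFunc K) β ≠ 0 := by simpa using hβ
  rw [div_eq_iff hβ', ← RatFunc.algebraMap_C, ← map_mul] at hc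
  have := IsFractionRing.injective K[X] (RatFunc K) hc
  exact one_ne_zero (h 1 (-c) (by rw [this]; simp)).1

theorem finiteDimensional_adjoin_of_transcendental {K : Type*} [Field K] {s : RatFunc K}
    (hs : Transcendental K s) : FiniteDimensional K⟮s⟯ (RatFunc K) := by
  have h : ¬ ∃ c, s = RatFunc.C c := by
    rintro ⟨c, rfl⟩
    exact hs (isAlgebraic_algebraMap c)
  have : FiniteDimensional K⟮s⟯ K⟮s⟯⟮(RatFunc.X : RatFunc K)⟯ :=
    IntermediateField.adjoin.finiteDimensional
      (isAlgebraic_iff_isIntegral.1 (RatFunc.isAlgebraic_adjoin_simple_X s h))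
  exact (RatFunc.IntermediateField.adjoinXEquiv K⟮s⟯).toLinearEquiv.finiteDimensional

theorem algebraMap_aeval_eq {K : Type*} [Field K] (p : Fin 3 → K[X]) (G : MvPolynomial (Fin 3) K) :
    algebraMap K[X] (RatFunc K) (MvPolynomial.aeval p G) =
      MvPolynomial.aeval (fun i => algebraMap K[X] (RatFunc K) (p i)) G := by
  change (IsScalarTower.toAlgHom K K[X] (RatFunc K)) _ = _
  rw [← AlgHom.comp_apply, MvPolynomial.comp_aeval]
  rfl

/-- The ratio p₁/p₂ is nonconstant, hence transcendental, so no form relates p₁ and p₂ alone. This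
supplies `hinj` when the coordinate ring is read as polynomials in the first variable over the other
two. -/
theorem coneHom_rename_injective {K : Type*} [Field K] [Infinite K] {p : Fin 3 → K[X]}
    (hp : LinearIndependent K p) {H : MvPolynomial (Fin 2) K}
    (h : coneHom p (MvPolynomial.rename Fin.succ H) = 0) : H = 0 := by
  have hp' := Fintype.linearIndependent_iff.1 hp
  obtain ⟨hβ, hs⟩ := ne_zero_and_transcendental_div (α := p 1) (β := p 2) fun a b hab => by
    have := hp' ![0, a, b] (by simpa [Fin.sum_univ_three, Polynomial.smul_eq_C_mul] using hab)
    exact ⟨by simpa using this 1, by simpa using this 2⟩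
  have hβ' : algebraMap K[X] (RatFunc K) (p 2) ≠ 0 := by simpa using hβ
  set β := algebraMap K[X] (RatFunc K) (p 2)
  set s := algebraMap K[X] (RatFunc K) (p 1) / β with hsdef
  -- This cyclic frame turns the generic point into (X, s, 1). The renamed form ignores the first
  -- entry.
  have hM : (!![0, 0, 1; 1, 0, 0; 0, 1, 0] : Matrix (Fin 3) (Fin 3) K) *
      !![0, 1, 0; 0, 0, 1; 1, 0, 0] = 1 := by
    ext i j
    fin_cases i <;> fin_cases j <;> simp [Matrix.mul_apply, Fin.sum_univ_three]
  rw [← MvPolynomial.sum_homogeneousComponent H]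
  refine Finset.sum_eq_zero fun k _ => ?_
  have hk := (mem_ker_coneHom_iff p _).1 h k
  rw [← MvPolynomial.rename_homogeneousComponent] at hk
  set Hk := MvPolynomial.homogeneousComponent k H
  have hHk : Hk.IsHomogeneous k := MvPolynomial.homogeneousComponent_isHomogeneous k H
  by_contra hne
  refine aeval_affine_ne_zero hM hs (hHk.rename_isHomogeneous (f := Fin.succ))
    (fun h0 => hne (MvPolynomial.rename_injective _ (Fin.succ_injective 2)
      (h0.trans (map_zero _).symm))) ?_
  have h1 := congrArg (algebraMap K[X] (RatFunc K)) hk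
  rw [map_zero, algebraMap_aeval_eq, MvPolynomial.aeval_rename] at h1
  have h2 : (fun i : Fin 3 => algebraMap K[X] (RatFunc K) (p i)) ∘ Fin.succ =
      fun i => β * ![s, 1] i := by
    funext i
    match i with
    | 0 => simp [hsdef, mul_div_cancel₀ _ hβ']
    | 1 => simp [β]
  rw [h2, MvPolynomial.aeval_mul_of_isHomogeneous hHk, mul_eq_zero,
    or_iff_right (pow_ne_zero _ hβ')] at h1
  rw [MvPolynomial.aeval_rename]
  have h3 := congrArg (Polynomial.CAlgHom (R := K) (A := RatFunc K)) h1
  rw [map_zero, ← AlgHom.comp_apply, MvPolynomial.comp_aeval] at h3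
  rw [← h3]
  congr 2
  funext i
  match i with
  | 0 => simp
  | 1 => simp

/-- K(t) is finite over K(p₀/p₁), so p₂/p₁ satisfies an algebraic relation over it; homogenizing
that relation gives a nonzero element. -/
theorem ker_coneHom_ne_bot {K : Type*} [Field K] [Infinite K] {p : Fin 3 → K[X]}
    (hp : LinearIndependent K p) : RingHom.ker (coneHom p) ≠ ⊥ := by
  have hp' := Fintype.linearIndependent_iff.1 hp
  obtain ⟨hβ, hs⟩ := ne_zero_and_transcendental_div (α := p 0) (β := p 1) fun a b hab => by
    have := hp' ![a, b, 0] (by simpa [Fin.sum_univ_three, Polynomial.smul_eq_C_mul] using hab)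
    exact ⟨by simpa using this 0, by simpa using this 1⟩
  have hβ' : algebraMap K[X] (RatFunc K) (p 1) ≠ 0 := by simpa using hβ
  have := finiteDimensional_adjoin_of_transcendental hs
  set β := algebraMap K[X] (RatFunc K) (p 1)
  set s := algebraMap K[X] (RatFunc K) (p 0) / β with hsdef
  set z := algebraMap K[X] (RatFunc K) (p 2) / β with hzdef
  obtain ⟨g, hg0, -, hg⟩ := exists_bivariate_relation hs (IsIntegral.of_finite K⟮s⟯ z)
  obtain ⟨n, G, hG, hG0, -, hval⟩ := exists_homogenization (M := (1 : Matrix (Fin 3) (Fin 3) K))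
    (N := 1) (by simp) hg0
  intro hbot
  refine hG0 ?_
  rw [← Ideal.mem_bot, ← hbot, RingHom.mem_ker, coneHom_of_isHomogeneous p hG]
  have h1 := hval s z
  rw [hg] at h1
  have h2 : algebraMap K[X] (RatFunc K) (MvPolynomial.aeval p G) = 0 := by
    rw [algebraMap_aeval_eq]
    have : (fun i => algebraMap K[X] (RatFunc K) (p i)) = fun i => β *
        (s * algebraMap K (RatFunc K) ((1 : Matrix (Fin 3) (Fin 3) K) i 0) +
        algebraMap K (RatFunc K) ((1 : Matrix (Fin 3) (Fin 3) K) i 1) +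
        algebraMap K (RatFunc K) ((1 : Matrix (Fin 3) (Fin 3) K) i 2) * z) := by
      funext i
      match i with
      | 0 => simp [hsdef, mul_div_cancel₀ _ hβ']
      | 1 => simp [β]
      | 2 => simp [hzdef, mul_div_cancel₀ _ hβ']
    rw [this, MvPolynomial.aeval_mul_of_isHomogeneous hG, h1, mul_zero]
  have h3 : MvPolynomial.aeval p G = 0 :=
    IsFractionRing.injective K[X] (RatFunc K) (by rw [h2, map_zero])
  rw [h3, map_zero, mul_zero]

/-- The homogeneous relations between three linearly independent polynomials are generated by a
single form. -/
theorem exists_form_ker_coneHom {K : Type*} [Field K] [Infinite K] {p : Fin 3 → K[X]}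
    (hp : LinearIndependent K p) : ∃ F, (∃ n : ℕ, F.IsHomogeneous n) ∧
      Ideal.span {F} = RingHom.ker (coneHom p) := by
  let e := MvPolynomial.finSuccEquiv K 2
  have hren : ∀ H : MvPolynomial (Fin 2) K, e.symm (C H) = MvPolynomial.rename Fin.succ H := by
    intro H
    rw [AlgEquiv.symm_apply_eq]
    induction H using MvPolynomial.induction_on with
    | C a =>
      rw [MvPolynomial.rename_C, ← MvPolynomial.algebraMap_eq, ← MvPolynomial.algebraMap_eq,
        AlgEquiv.commutes]
      rfl
    | add q r hq hr => rw [map_add, map_add, map_add, hq, hr]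
    | mul_X q i hq =>
      rw [map_mul, map_mul, map_mul, hq, MvPolynomial.rename_X, MvPolynomial.finSuccEquiv_X_succ]
  obtain ⟨f, hf⟩ := exists_map_eq_zero_iff_dvd ((coneHom p : _ →+* K[X][X]).comp
    (e.symm : (MvPolynomial (Fin 2) K)[X] →+* MvPolynomial (Fin 3) K))
    fun H hH => coneHom_rename_injective hp ((congrArg (coneHom p) (hren H)).symm.trans hH)
  have hspan : Ideal.span {e.symm f} = RingHom.ker (coneHom p) := by
    ext G
    have h1 : coneHom p G = 0 ↔ f ∣ e G := by
      rw [← hf]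
      exact Eq.congr_left (congrArg (coneHom p) (e.symm_apply_apply G).symm)
    rw [Ideal.mem_span_singleton, RingHom.mem_ker, h1]
    constructor
    · rintro ⟨H, rfl⟩
      exact ⟨e H, by rw [map_mul, e.apply_symm_apply]⟩
    · rintro ⟨H, hH⟩
      exact ⟨e.symm H, by rw [← map_mul, ← hH, e.symm_apply_apply]⟩
  refine ⟨e.symm f, MvPolynomial.exists_isHomogeneous_of_span_singleton fun k => ?_, hspan⟩
  have hmem : e.symm f ∈ RingHom.ker (coneHom p) := hspan ▸ Ideal.mem_span_singleton_self _
  rw [hspan, mem_ker_coneHom_iff]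
  rw [mem_ker_coneHom_iff] at hmem
  intro j
  have h2 := MvPolynomial.homogeneousComponent_of_mem (m := j)
    (MvPolynomial.homogeneousComponent_mem k (e.symm f))
  rw [h2]
  split_ifs
  · exact hmem k
  · exact map_zero _

/-! ### Frames, properness and degrees of rational functions -/

theorem exists_matrix_with_column {K : Type*} [Field K] {v : Fin 3 → K} (hv : v ≠ 0) :
    ∃ M N : Matrix (Fin 3) (Fin 3) K, M * N = 1 ∧ ∀ i, M i 2 = v i := by
  suffices h : ∃ M : Matrix (Fin 3) (Fin 3) K, M.det ≠ 0 ∧ ∀ i, M i 2 = v i by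
    obtain ⟨M, hdet, hM⟩ := h
    exact ⟨M, M⁻¹, Matrix.mul_nonsing_inv _ (isUnit_iff_ne_zero.2 hdet), hM⟩
  have hcol : ∀ M : Matrix (Fin 3) (Fin 3) K, M 0 2 = v 0 → M 1 2 = v 1 → M 2 2 = v 2 →
      ∀ i, M i 2 = v i := fun M h0 h1 h2 i => by
    match i with
    | 0 => exact h0
    | 1 => exact h1
    | 2 => exact h2
  by_cases h0 : v 0 = 0
  · by_cases h1 : v 1 = 0
    · have h2 : v 2 ≠ 0 := fun h2 => hv (funext fun i => by
        match i with
        | 0 => exact h0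
        | 1 => exact h1
        | 2 => exact h2)
      exact ⟨!![1, 0, v 0; 0, 1, v 1; 0, 0, v 2], by simpa [Matrix.det_fin_three] using h2,
        hcol _ rfl rfl rfl⟩
    · exact ⟨!![1, 0, v 0; 0, 0, v 1; 0, 1, v 2], by simpa [Matrix.det_fin_three] using h1,
        hcol _ rfl rfl rfl⟩
  · exact ⟨!![0, 0, v 0; 1, 0, v 1; 0, 1, v 2], by simpa [Matrix.det_fin_three] using h0,
      hcol _ rfl rfl rfl⟩

/-- Quotients of coordinates do not change when all are divided by β, so E contains the function
field of the curve, which is K(t) by properness. -/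
theorem PlaneParametrization.IsProper.eq_top_of_div_mem {K : Type*} [Field K]
    {P : PlaneParametrization K} (hP : P.IsProper) (E : IntermediateField K (RatFunc K))
    {β : RatFunc K} (hβ : β ≠ 0)
    (h : ∀ i, algebraMap K[X] (RatFunc K) (P.coords i) / β ∈ E) : E = ⊤ := by
  have htop : P.functionField = ⊤ := IntermediateField.finrank_eq_one_iff_eq_top.1 hP
  rw [eq_top_iff, ← htop, PlaneParametrization.functionField, IntermediateField.adjoin_le_iff]
  rintro f ⟨i, j, -, rfl⟩
  rw [← div_div_div_cancel_right₀ hβ]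
  exact E.div_mem (h i) (h j)

theorem natDegree_num_denom_div {K : Type*} [Field K] {a b : K[X]} (hb : b ≠ 0)
    (hcop : IsCoprime a b) :
    (algebraMap K[X] (RatFunc K) a / algebraMap K[X] (RatFunc K) b).num.natDegree = a.natDegree ∧
    (algebraMap K[X] (RatFunc K) a / algebraMap K[X] (RatFunc K) b).denom.natDegree =
      b.natDegree := by
  have hmul := (RatFunc.num_mul_eq_mul_denom_iff (p := a) hb).2 rfl
  have hsc := RatFunc.isCoprime_num_denom
    (algebraMap K[X] (RatFunc K) a / algebraMap K[X] (RatFunc K) b)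
  generalize (algebraMap K[X] (RatFunc K) a / algebraMap K[X] (RatFunc K) b).num = m at *
  generalize (algebraMap K[X] (RatFunc K) a / algebraMap K[X] (RatFunc K) b).denom = n at *
  have hnum : Associated m a := associated_of_dvd_dvd
    (hsc.dvd_of_dvd_mul_right (Dvd.intro _ hmul)) (hcop.dvd_of_dvd_mul_right (Dvd.intro _ hmul.symm))
  have hden : Associated n b := associated_of_dvd_dvd
    (hsc.symm.dvd_of_dvd_mul_left (Dvd.intro_left _ hmul.symm))
    (hcop.symm.dvd_of_dvd_mul_left (Dvd.intro_left _ hmul))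
  exact ⟨Polynomial.natDegree_eq_of_degree_eq (Polynomial.degree_eq_degree_of_associated hnum),
    Polynomial.natDegree_eq_of_degree_eq (Polynomial.degree_eq_degree_of_associated hden)⟩

/-- The degree of the rational function `α / β`. -/
theorem finrank_adjoin_div_add_natDegree {K : Type*} [Field K] {α β g : K[X]} (hβ : β ≠ 0)
    (hg : ∀ h, h ∣ g ↔ h ∣ α ∧ h ∣ β) :
    Module.finrank K⟮algebraMap K[X] (RatFunc K) α / algebraMap K[X] (RatFunc K) β⟯ (RatFunc K) +
      g.natDegree = max α.natDegree β.natDegree := by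
  obtain ⟨⟨a, rfl⟩, ⟨b, rfl⟩⟩ := (hg g).1 dvd_rfl
  have hg0 : g ≠ 0 := left_ne_zero_of_mul hβ
  have hb0 : b ≠ 0 := right_ne_zero_of_mul hβ
  have hcop : IsCoprime a b := by
    refine EuclideanDomain.isCoprime_of_dvd (fun h => hb0 h.2) fun h hu _ ha hb => hu ?_
    have h1 : g * h ∣ g * 1 := by
      rw [mul_one]
      exact (hg _).2 ⟨mul_dvd_mul_left g ha, mul_dvd_mul_left g hb⟩
    exact isUnit_of_dvd_one ((mul_dvd_mul_iff_left hg0).1 h1)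
  have hdiv : algebraMap K[X] (RatFunc K) (g * a) / algebraMap K[X] (RatFunc K) (g * b) =
      algebraMap K[X] (RatFunc K) a / algebraMap K[X] (RatFunc K) b := by
    rw [map_mul, map_mul, mul_div_mul_left]
    simpa using hg0
  rw [hdiv, RatFunc.finrank_eq_max_natDegree]
  rw [(natDegree_num_denom_div hb0 hcop).1, (natDegree_num_denom_div hb0 hcop).2]
  rw [Polynomial.natDegree_mul hg0 hb0]
  by_cases ha : a = 0
  · subst ha
    have hbu : IsUnit b := isCoprime_zero_left.1 hcop
    simp [Polynomial.natDegree_eq_zero_of_isUnit hbu]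
  · rw [Polynomial.natDegree_mul hg0 ha, Nat.add_max_add_left, add_comm]

/-! ### Frame coordinates, visible and hidden multiplicity -/

/-- The coordinates of the polynomial vector `p` in the frame dual to the rows of `N`. -/
def frameCoord {K : Type*} [Field K] (N : Matrix (Fin 3) (Fin 3) K) (p : Fin 3 → K[X])
    (j : Fin 3) : K[X] :=
  ∑ k, C (N j k) * p k

theorem sum_frameCoord {K : Type*} [Field K] {M N : Matrix (Fin 3) (Fin 3) K} (hMN : M * N = 1)
    (p : Fin 3 → K[X]) (i : Fin 3) :
    p i = C (M i 0) * frameCoord N p 0 + C (M i 1) * frameCoord N p 1 +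
      C (M i 2) * frameCoord N p 2 := by
  have := sum_matrix_mul_eq hMN p i
  rw [Fin.sum_univ_three] at this
  exact this.symm

/-- The fibre function is the gcd of the 2 × 2 minors of v and p, where v is the third column of M.
The minors vanish modulo h exactly when p is a multiple of v there, that is, when the other two
frame coordinates vanish. -/
theorem dvd_fibreFunction_iff {K : Type*} [Field K] {M N : Matrix (Fin 3) (Fin 3) K}
    (hMN : M * N = 1) (p : Fin 3 → K[X]) (h : K[X]) :
    h ∣ fibreFunction p (fun i => M i 2) ↔ h ∣ frameCoord N p 0 ∧ h ∣ frameCoord N p 1 := by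
  classical
  have hNM : N * M = 1 := mul_eq_one_comm.1 hMN
  have hgcd : ∀ a b : K[X], h ∣ EuclideanDomain.gcd a b ↔ h ∣ a ∧ h ∣ b := fun a b =>
    ⟨fun hd => ⟨hd.trans (EuclideanDomain.gcd_dvd_left a b),
      hd.trans (EuclideanDomain.gcd_dvd_right a b)⟩, fun hd => EuclideanDomain.dvd_gcd hd.1 hd.2⟩
  rw [fibreFunction, hgcd, hgcd]
  constructor
  · rintro ⟨h1, h2, h3⟩
    have hw : ∀ i k, h ∣ C (M i 2) * p k - C (M k 2) * p i := by
      have key : ∀ i k, h ∣ C (M i 2) * p k - C (M k 2) * p i →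
          h ∣ C (M k 2) * p i - C (M i 2) * p k := fun i k hik => by
        rw [← neg_sub]
        exact (dvd_neg.2 hik)
      intro i k
      match i, k with
      | 0, 0 => simp
      | 0, 1 => exact h3
      | 0, 2 => exact h1
      | 1, 0 => exact key _ _ h3
      | 1, 1 => simp
      | 1, 2 => exact h2
      | 2, 0 => exact key _ _ h1
      | 2, 1 => exact key _ _ h2
      | 2, 2 => simp
    obtain ⟨i, hi⟩ : ∃ i, M i 2 ≠ 0 := by
      by_contra! hcon
      have h22 : (N * M) 2 2 = 1 := by rw [hNM]; simp
      rw [Matrix.mul_apply] at h22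
      simp [hcon] at h22
    have hj : ∀ j, ∑ k, N j k * M k 2 = 0 → h ∣ frameCoord N p j := by
      intro j hj
      have hz : ∑ k, C (N j k) * C (M k 2) = (0 : K[X]) := by
        rw [← map_zero C, ← hj, map_sum]
        exact Finset.sum_congr rfl fun k _ => (map_mul _ _ _).symm
      -- Row j annihilates v, so subtracting multiples of p i changes nothing and leaves a
      -- combination of minors. The factor C (M i 2) is a unit.
      have h4 : C (M i 2) * frameCoord N p j =
          ∑ k, C (N j k) * (C (M i 2) * p k - C (M k 2) * p i) := by
        simp only [mul_sub, Finset.sum_sub_distrib]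
        have : ∑ k, C (N j k) * (C (M k 2) * p i) = 0 := by
          simp only [← mul_assoc, ← Finset.sum_mul, hz, zero_mul]
        rw [this, sub_zero, frameCoord, Finset.mul_sum]
        exact Finset.sum_congr rfl fun k _ => by ring
      have h5 : h ∣ C (M i 2) * frameCoord N p j := by
        rw [h4]
        exact Finset.dvd_sum fun k _ => (hw i k).mul_left _
      have hu : IsUnit (C (M i 2)) := Polynomial.isUnit_C.2 (isUnit_iff_ne_zero.2 hi)
      exact (hu.dvd_mul_left).1 h5
    have hrow : ∀ j, ∑ k, N j k * M k 2 = (1 : Matrix (Fin 3) (Fin 3) K) j 2 := fun j => by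
      rw [← hNM, Matrix.mul_apply]
    exact ⟨hj 0 (by rw [hrow]; simp), hj 1 (by rw [hrow]; simp)⟩
  · rintro ⟨h0, h1⟩
    have hw : ∀ i k, h ∣ C (M i 2) * p k - C (M k 2) * p i := by
      intro i k
      rw [sum_frameCoord hMN p i, sum_frameCoord hMN p k]
      have : C (M i 2) * (C (M k 0) * frameCoord N p 0 + C (M k 1) * frameCoord N p 1 +
            C (M k 2) * frameCoord N p 2) -
          C (M k 2) * (C (M i 0) * frameCoord N p 0 + C (M i 1) * frameCoord N p 1 +
            C (M i 2) * frameCoord N p 2) =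
          (C (M i 2) * C (M k 0) - C (M k 2) * C (M i 0)) * frameCoord N p 0 +
          (C (M i 2) * C (M k 1) - C (M k 2) * C (M i 1)) * frameCoord N p 1 := by ring
      rw [this]
      exact dvd_add (h0.mul_left _) (h1.mul_left _)
    exact ⟨hw 0 2, hw 1 2, hw 0 1⟩

theorem X_pow_dvd_reflect_iff {K : Type*} [Field K] {f : K[X]} {d k : ℕ} (hf : f ≠ 0)
    (hd : f.natDegree ≤ d) : X ^ k ∣ f.reflect d ↔ k + f.natDegree ≤ d := by
  rw [Polynomial.X_pow_dvd_iff]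
  constructor
  · intro h
    by_contra! hlt
    have := h (d - f.natDegree) (by omega)
    rw [Polynomial.coeff_reflect, Polynomial.revAt_le (by omega), Nat.sub_sub_self hd] at this
    exact hf (Polynomial.leadingCoeff_eq_zero.1 this)
  · intro h i hi
    rw [Polynomial.coeff_reflect, Polynomial.revAt_le (by omega)]
    exact Polynomial.coeff_eq_zero_of_natDegree_lt (by omega)

theorem frameCoord_reflect {K : Type*} [Field K] (N : Matrix (Fin 3) (Fin 3) K)
    (p : Fin 3 → K[X]) (d : ℕ) (j : Fin 3) :
    frameCoord N (fun i => (p i).reflect d) j = (frameCoord N p j).reflect d := by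
  simp only [frameCoord, Fin.sum_univ_three, Polynomial.reflect_add, Polynomial.reflect_C_mul]

namespace PlaneParametrization

variable {K : Type*} [Field K] (P : PlaneParametrization K)

theorem natDegree_coords_le (i : Fin 3) : (P.coords i).natDegree ≤ P.deg :=
  Finset.le_sup (f := fun i => (P.coords i).natDegree) (Finset.mem_univ i)

theorem natDegree_frameCoord_le (N : Matrix (Fin 3) (Fin 3) K) (j : Fin 3) :
    (frameCoord N P.coords j).natDegree ≤ P.deg :=
  Polynomial.natDegree_sum_le_of_forall_le _ _ fun k _ =>
    (Polynomial.natDegree_C_mul_le _ _).trans (P.natDegree_coords_le k)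

/-- Frame coordinates commute with reversal, and reversing q at degree d gives order d - deg q at 0.
The gcd has the smaller of the two orders. -/
theorem rootMultiplicity_fibreFunction_reversedCoords {M N : Matrix (Fin 3) (Fin 3) K}
    (hMN : M * N = 1) (h0 : frameCoord N P.coords 0 ≠ 0) (h1 : frameCoord N P.coords 1 ≠ 0) :
    (fibreFunction P.reversedCoords fun i => M i 2).rootMultiplicity 0 +
      max (frameCoord N P.coords 0).natDegree (frameCoord N P.coords 1).natDegree = P.deg := by
  set H := fibreFunction P.reversedCoords fun i => M i 2
  have hd0 := P.natDegree_frameCoord_le N 0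
  have hd1 := P.natDegree_frameCoord_le N 1
  have hH : ∀ h, h ∣ H ↔ h ∣ (frameCoord N P.coords 0).reflect P.deg ∧
      h ∣ (frameCoord N P.coords 1).reflect P.deg := fun h => by
    rw [dvd_fibreFunction_iff hMN]
    simp only [← frameCoord_reflect]
    rfl
  have hH0 : H ≠ 0 := by
    intro h
    have := ((hH 0).1 (by rw [h])).1
    rw [zero_dvd_iff, Polynomial.reflect_eq_zero_iff] at this
    exact h0 this
  have hk : ∀ k, k ≤ H.rootMultiplicity 0 ↔
      k + max (frameCoord N P.coords 0).natDegree (frameCoord N P.coords 1).natDegree ≤ P.deg := by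
    intro k
    rw [Polynomial.le_rootMultiplicity_iff hH0, map_zero, sub_zero, hH,
      X_pow_dvd_reflect_iff h0 hd0, X_pow_dvd_reflect_iff h1 hd1]
    omega
  have h2 := (hk _).1 le_rfl
  have h3 := (hk (P.deg - max (frameCoord N P.coords 0).natDegree
    (frameCoord N P.coords 1).natDegree)).2 (by omega)
  omega

/-! ### The homogeneous ideal of the parametrized curve -/

theorem vanishesAt_point_iff {n : ℕ} {F : MvPolynomial (Fin 3) K} (hF : F.IsHomogeneous n) (t : K) :
    VanishesAt F (P.point t) ↔ (MvPolynomial.aeval P.coords F).eval t = 0 := by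
  obtain ⟨a, ha⟩ := Projectivization.exists_smul_eq_mk_rep K _ (P.eval_ne_zero t)
  have h1 : (MvPolynomial.aeval P.coords F).eval t =
      MvPolynomial.aeval (fun i => (P.coords i).eval t) F := by
    change (Polynomial.aeval t : K[X] →ₐ[K] K) _ = _
    rw [← AlgHom.comp_apply, MvPolynomial.comp_aeval]
    rfl
  have h2 : MvPolynomial.eval (P.point t).rep F =
      (a : K) ^ n * MvPolynomial.aeval (fun i => (P.coords i).eval t) F := by
    rw [← MvPolynomial.aeval_mul_of_isHomogeneous hF, MvPolynomial.aeval_eq_eval]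
    rw [point, ← ha]
    rfl
  rw [VanishesAt, h2, h1, mul_eq_zero, or_iff_right (pow_ne_zero _ a.ne_zero)]

theorem mem_vanishingForms_curve_iff [Infinite K] (F : MvPolynomial (Fin 3) K) :
    F ∈ vanishingForms P.curve ↔
      (∃ n : ℕ, F.IsHomogeneous n) ∧ MvPolynomial.aeval P.coords F = 0 := by
  constructor
  · rintro ⟨⟨n, hn⟩, h⟩
    refine ⟨⟨n, hn⟩, Polynomial.funext fun t => ?_⟩
    rw [eval_zero, ← vanishesAt_point_iff P hn]
    exact h _ fun G hG => hG.2 _ ⟨t, rfl⟩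
  · rintro ⟨⟨n, hn⟩, h⟩
    refine ⟨⟨n, hn⟩, fun x hx => hx F ⟨⟨n, hn⟩, ?_⟩⟩
    rintro _ ⟨t, rfl⟩
    rw [vanishesAt_point_iff P hn, h, eval_zero]

theorem homogeneousIdeal_curve [Infinite K] :
    homogeneousIdeal P.curve = RingHom.ker (coneHom P.coords) := by
  refine le_antisymm (Ideal.span_le.2 fun F hF => ?_) fun F hF => ?_
  · obtain ⟨⟨n, hn⟩, h⟩ := (P.mem_vanishingForms_curve_iff F).1 hF
    rw [SetLike.mem_coe, RingHom.mem_ker, coneHom_of_isHomogeneous _ hn, h, map_zero, mul_zero]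
  · rw [mem_ker_coneHom_iff] at hF
    rw [← MvPolynomial.sum_homogeneousComponent F]
    exact Ideal.sum_mem _ fun k _ => Ideal.subset_span ((P.mem_vanishingForms_curve_iff _).2
      ⟨⟨k, MvPolynomial.homogeneousComponent_isHomogeneous k F⟩, hF k⟩)

end PlaneParametrization

/-! ### The projection formula and the degree of the curve -/

theorem eval_frameCoord {K : Type*} [Field K] (N : Matrix (Fin 3) (Fin 3) K)
    (p : Fin 3 → K[X]) (j : Fin 3) (t : K) :
    (frameCoord N p j).eval t = ∑ k, N j k * (p k).eval t := by
  simp [frameCoord, Polynomial.eval_finsetSum]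

theorem coeff_frameCoord {K : Type*} [Field K] (N : Matrix (Fin 3) (Fin 3) K)
    (p : Fin 3 → K[X]) (j : Fin 3) (d : ℕ) :
    (frameCoord N p j).coeff d = ∑ k, N j k * (p k).coeff d := by
  simp [frameCoord, Polynomial.finsetSum_coeff]

theorem frameCoord_combination_eq_zero {K : Type*} [Field K] {M N : Matrix (Fin 3) (Fin 3) K}
    (hMN : M * N = 1) {p : Fin 3 → K[X]} (hp : LinearIndependent K p) {a : Fin 3 → K}
    (h : ∑ j, C (a j) * frameCoord N p j = 0) : a = 0 := by
  have h1 : ∑ k, (Matrix.vecMul a N k) • p k = 0 := by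
    rw [← h]
    simp only [frameCoord, Finset.mul_sum]
    rw [Finset.sum_comm]
    refine Finset.sum_congr rfl fun k _ => ?_
    simp only [Matrix.vecMul, dotProduct, Polynomial.smul_eq_C_mul, map_sum, Finset.sum_mul,
      map_mul, mul_assoc]
  have h2 : Matrix.vecMul a N = 0 := funext (Fintype.linearIndependent_iff.1 hp _ h1)
  have h3 := Matrix.vecMul_vecMul a N M
  rw [mul_eq_one_comm.1 hMN, Matrix.vecMul_one, h2, Matrix.zero_vecMul] at h3
  exact h3.symm

/-- Setting X = 0 in F(X + T w) leaves Tⁿ F(w). -/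
theorem natDegree_shiftAlong_of_eval_ne_zero {K : Type*} [Field K]
    {F : MvPolynomial (Fin 3) K} {n : ℕ} (hF : F.IsHomogeneous n) {w : Fin 3 → K}
    (hw : MvPolynomial.eval w F ≠ 0) : (MvPolynomial.shiftAlong F w).natDegree = n := by
  refine le_antisymm (hF.natDegree_shiftAlong_le w) ?_
  have h1 := MvPolynomial.aeval_shiftAlong F w (fun _ => (0 : K[X])) X
  have h2 : MvPolynomial.aeval (fun i => 0 + algebraMap K K[X] (w i) * X) F =
      X ^ n * C (MvPolynomial.eval w F) := by
    have h3 : (fun i => 0 + algebraMap K K[X] (w i) * X) = fun i => X * C (w i) := by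
      funext i
      rw [zero_add, mul_comm]
      rfl
    rw [h3, MvPolynomial.aeval_mul_of_isHomogeneous hF, ← MvPolynomial.aeval_eq_eval]
    congr 1
    have := MvPolynomial.comp_aeval (R := K) w (Polynomial.CAlgHom (R := K) (A := K))
    exact (congrArg (fun f => f F) this).symm
  have h4 : (MvPolynomial.shiftAlong F w).eval₂
      (MvPolynomial.aeval (fun _ => (0 : K[X])) : MvPolynomial (Fin 3) K →ₐ[K] K[X]).toRingHom X =
      (MvPolynomial.shiftAlong F w).map (MvPolynomial.eval (fun _ => (0 : K))) := by
    rw [Polynomial.map]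
    congr 1
    ext <;> simp
  rw [h4, h2] at h1
  have h5 : ((MvPolynomial.shiftAlong F w).map (MvPolynomial.eval (fun _ => (0 : K)))).natDegree
      = n := by
    rw [h1, Polynomial.natDegree_mul_C hw, Polynomial.natDegree_X_pow]
  rw [← h5]
  exact Polynomial.natDegree_map_le

namespace PlaneParametrization

variable {K : Type*} [Field K] (P : PlaneParametrization K)

/-- Both terms come from the projection q₀/q₁: the T-degree is its degree as a rational function,
and the fibre function is the factor that cancels between q₀ and q₁. -/
theorem natDegree_shiftAlong_add_natDegree [Infinite K] (hP : P.IsProper)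
    (hind : LinearIndependent K P.coords) {n : ℕ} {F : MvPolynomial (Fin 3) K}
    (hF : F.IsHomogeneous n) (h0 : F ≠ 0) (hroot : MvPolynomial.aeval P.coords F = 0)
    (hdvd : ∀ k (G : MvPolynomial (Fin 3) K), G.IsHomogeneous k →
      MvPolynomial.aeval P.coords G = 0 → F ∣ G)
    {M N : Matrix (Fin 3) (Fin 3) K} (hMN : M * N = 1) :
    (MvPolynomial.shiftAlong F fun i => M i 2).natDegree +
      (fibreFunction P.coords fun i => M i 2).natDegree =
      max (frameCoord N P.coords 0).natDegree (frameCoord N P.coords 1).natDegree := by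
  obtain ⟨hβ, hs⟩ := ne_zero_and_transcendental_div (α := frameCoord N P.coords 0)
    (β := frameCoord N P.coords 1) fun a b hab => by
      have := frameCoord_combination_eq_zero hMN hind (a := ![a, b, 0])
        (by simpa [Fin.sum_univ_three] using hab)
      exact ⟨by simpa using congrFun this 0, by simpa using congrFun this 1⟩
  rw [← finrank_adjoin_div_add_natDegree hβ (dvd_fibreFunction_iff hMN P.coords)]
  congr 1
  have hβ' : algebraMap K[X] (RatFunc K) (frameCoord N P.coords 1) ≠ 0 := by simpa using hβ
  have hfin := finiteDimensional_adjoin_of_transcendental hs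
  have hx : ∀ i, algebraMap K[X] (RatFunc K) (P.coords i) =
      algebraMap K[X] (RatFunc K) (frameCoord N P.coords 1) *
      (algebraMap K[X] (RatFunc K) (frameCoord N P.coords 0) /
        algebraMap K[X] (RatFunc K) (frameCoord N P.coords 1) * algebraMap K (RatFunc K) (M i 0) +
      algebraMap K (RatFunc K) (M i 1) + algebraMap K (RatFunc K) (M i 2) *
      (algebraMap K[X] (RatFunc K) (frameCoord N P.coords 2) /
        algebraMap K[X] (RatFunc K) (frameCoord N P.coords 1))) := by
    intro i
    have hC : ∀ r : K, algebraMap K[X] (RatFunc K) (C r) = algebraMap K (RatFunc K) r := fun r =>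
      (IsScalarTower.algebraMap_apply K K[X] (RatFunc K) r).symm
    conv_lhs => rw [sum_frameCoord hMN P.coords i]
    simp only [map_add, map_mul, hC]
    field_simp
  have haeval : ∀ G : MvPolynomial (Fin 3) K, MvPolynomial.aeval P.coords G = 0 ↔
      MvPolynomial.aeval (fun i => algebraMap K[X] (RatFunc K) (P.coords i)) G = 0 := fun G => by
    rw [← algebraMap_aeval_eq, map_eq_zero_iff _ (IsFractionRing.injective K[X] (RatFunc K))]
  refine natDegree_shiftAlong_eq_finrank (z := algebraMap K[X] (RatFunc K)
    (frameCoord N P.coords 2) / algebraMap K[X] (RatFunc K) (frameCoord N P.coords 1)) hMN hs hfin (fun E hsE hzE => ?_) hF h0 hβ' ?_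
    fun k G hG hG0 => hdvd k G hG ?_
  · refine hP.eq_top_of_div_mem E hβ' fun i => ?_
    rw [hx i, mul_div_cancel_left₀ _ hβ']
    exact E.add_mem (E.add_mem (E.mul_mem hsE (E.algebraMap_mem _)) (E.algebraMap_mem _))
      (E.mul_mem (E.algebraMap_mem _) hzE)
  · simp only [← hx]
    exact (haeval F).1 hroot
  · simp only [← hx] at hG0
    exact (haeval G).2 hG0

/-- The limit point is the value at 0 of the reversed parametrization, on which F vanishes for all t
≠ 0 and therefore identically. -/
theorem aeval_coeff_deg [Infinite K] {F : MvPolynomial (Fin 3) K} {n : ℕ} (hF : F.IsHomogeneous n)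
    (hroot : MvPolynomial.aeval P.coords F = 0) :
    MvPolynomial.aeval (fun i => (P.coords i).coeff P.deg) F = 0 := by
  have heval : ∀ (t : K) (q : Fin 3 → K[X]), (MvPolynomial.aeval q F).eval t =
      MvPolynomial.aeval (fun i => (q i).eval t) F := fun t q => by
    have := MvPolynomial.comp_aeval (R := K) q (Polynomial.aeval t : K[X] →ₐ[K] K)
    exact congrArg (fun f => f F) this
  have hR : MvPolynomial.aeval P.reversedCoords F * X = 0 := by
    refine Polynomial.funext fun t => ?_
    rw [eval_mul, eval_X, eval_zero]
    by_cases ht : t = 0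
    · rw [ht, mul_zero]
    rw [heval]
    have : (fun i => (P.reversedCoords i).eval t) =
        fun i => t ^ P.deg * (P.coords i).eval t⁻¹ := by
      funext i
      let _ : Invertible t⁻¹ := invertibleOfNonzero (inv_ne_zero ht)
      have h1 := Polynomial.eval₂_reflect_mul_pow (RingHom.id K) t⁻¹ P.deg (P.coords i)
        (P.natDegree_coords_le i)
      rw [invOf_eq_inv, inv_inv] at h1
      change Polynomial.eval₂ (RingHom.id K) t ((P.coords i).reflect P.deg) =
        t ^ P.deg * Polynomial.eval₂ (RingHom.id K) t⁻¹ (P.coords i)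
      rw [← h1, inv_pow]
      field_simp
    rw [this, MvPolynomial.aeval_mul_of_isHomogeneous hF, ← heval, hroot, eval_zero, mul_zero,
      zero_mul]
  have hR0 := (mul_eq_zero.1 hR).resolve_right X_ne_zero
  have h2 := heval 0 P.reversedCoords
  rw [hR0, eval_zero] at h2
  rw [h2]
  congr 2
  funext i
  rw [← Polynomial.coeff_zero_eq_eval_zero, reversedCoords, Polynomial.coeff_reflect,
    Polynomial.revAt_le (Nat.zero_le _), Nat.sub_zero]

/-- The degree of a defining form equals the degree of a proper parametrization. -/
theorem degree_eq_deg [IsAlgClosed K] (hP : P.IsProper)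
    (hind : LinearIndependent K P.coords) {n : ℕ} {F : MvPolynomial (Fin 3) K}
    (hF : F.IsHomogeneous n) (h0 : F ≠ 0) (hroot : MvPolynomial.aeval P.coords F = 0)
    (hdvd : ∀ k (G : MvPolynomial (Fin 3) K), G.IsHomogeneous k →
      MvPolynomial.aeval P.coords G = 0 → F ∣ G) : n = P.deg := by
  have : Infinite K := IsAlgClosed.instInfinite
  -- F(w) ≠ 0 puts w off the curve; the extra factor forces w ≠ 0.
  obtain ⟨w, hw⟩ : ∃ w : Fin 3 → K, MvPolynomial.eval w (F * MvPolynomial.X 0) ≠ 0 := by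
    by_contra! hcon
    exact mul_ne_zero h0 (MvPolynomial.X_ne_zero 0) (MvPolynomial.funext fun x => by
      rw [hcon x, map_zero])
  rw [map_mul, MvPolynomial.eval_X] at hw
  have hFw := left_ne_zero_of_mul hw
  obtain ⟨M, N, hMN, hMw⟩ := exists_matrix_with_column (v := w) fun h => by simp [h] at hw
  have hMw' : (fun i => M i 2) = w := funext hMw
  have key := P.natDegree_shiftAlong_add_natDegree hP hind hF h0 hroot hdvd hMN
  rw [hMw', natDegree_shiftAlong_of_eval_ne_zero hF hFw, ← hMw'] at key
  have hnot : ∀ (y : Fin 3 → K) (c : K), (∀ i, y i = c * w i) → MvPolynomial.aeval y F = 0 →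
      y = 0 := by
    intro y c hy h
    rw [show y = fun i => c * w i from funext hy, MvPolynomial.aeval_mul_of_isHomogeneous hF,
      MvPolynomial.aeval_eq_eval] at h
    have hc : c = 0 := by
      by_contra hc
      exact mul_ne_zero (pow_ne_zero n hc) hFw h
    funext i
    rw [hy, hc, zero_mul, Pi.zero_apply]
  -- A root t of the fibre function would place 𝒫(t) at w.
  have hgcd : (fibreFunction P.coords fun i => M i 2).natDegree = 0 := by
    by_contra hne
    obtain ⟨t, ht⟩ := IsAlgClosed.exists_root (fibreFunction P.coords fun i => M i 2)
      fun h => hne (Polynomial.natDegree_eq_of_degree_eq_some h)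
    obtain ⟨h1, h2⟩ := (dvd_fibreFunction_iff hMN P.coords (X - C t)).1 (dvd_iff_isRoot.2 ht)
    rw [dvd_iff_isRoot, IsRoot] at h1 h2
    refine P.eval_ne_zero t (hnot _ ((frameCoord N P.coords 2).eval t) (fun i => ?_) ?_)
    · rw [sum_frameCoord hMN P.coords i]
      simp [h1, h2, hMw, mul_comm]
    · have := MvPolynomial.comp_aeval (R := K) P.coords (Polynomial.aeval t : K[X] →ₐ[K] K)
      have h3 := congrArg (fun f => f F) this
      refine h3.symm.trans ?_
      rw [AlgHom.comp_apply, hroot, map_zero]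
  -- If both degrees dropped, the limit point would be w, although F vanishes at the limit point.
  have hmax : max (frameCoord N P.coords 0).natDegree (frameCoord N P.coords 1).natDegree =
      P.deg := by
    refine le_antisymm (max_le (P.natDegree_frameCoord_le N 0) (P.natDegree_frameCoord_le N 1)) ?_
    by_contra! hlt
    refine P.coeff_deg_ne_zero (hnot _ ((frameCoord N P.coords 2).coeff P.deg) (fun i => ?_)
      (P.aeval_coeff_deg hF hroot))
    have h1 := Polynomial.coeff_eq_zero_of_natDegree_lt ((le_max_left _ _).trans_lt hlt)
    have h2 := Polynomial.coeff_eq_zero_of_natDegree_lt ((le_max_right _ _).trans_lt hlt)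
    have h3 := congrArg (fun f => Polynomial.coeff f P.deg) (sum_frameCoord hMN P.coords i)
    simp only [Polynomial.coeff_add, Polynomial.coeff_C_mul, h1, h2] at h3
    rw [h3, hMw]
    ring
  omega

/-! ### The frame at the limit point and linear independence -/

/-- In a frame at the limit point, the first two coordinates drop in degree. -/
theorem coeff_deg_frameCoord {M N : Matrix (Fin 3) (Fin 3) K} (hMN : M * N = 1)
    (hM : ∀ i, M i 2 = P.limitPoint.rep i) :
    (frameCoord N P.coords 0).coeff P.deg = 0 ∧ (frameCoord N P.coords 1).coeff P.deg = 0 ∧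
      (frameCoord N P.coords 2).coeff P.deg ≠ 0 := by
  obtain ⟨a, ha⟩ := Projectivization.exists_smul_eq_mk_rep K _ P.coeff_deg_ne_zero
  have hrow : ∀ j, (a : K) * (frameCoord N P.coords j).coeff P.deg =
      (1 : Matrix (Fin 3) (Fin 3) K) j 2 := fun j => by
    rw [← mul_eq_one_comm.1 hMN, Matrix.mul_apply, coeff_frameCoord, Finset.mul_sum]
    refine Finset.sum_congr rfl fun k _ => ?_
    rw [hM, limitPoint, ← ha, mul_left_comm]
    rfl
  refine ⟨?_, ?_, fun h => ?_⟩
  · have := hrow 0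
    simpa using this
  · have := hrow 1
    simpa using this
  · have := hrow 2
    simp [h] at this

theorem eval_frameCoord_of_point_eq {M N : Matrix (Fin 3) (Fin 3) K} (hMN : M * N = 1) {t : K}
    (hM : ∀ i, M i 2 = (P.point t).rep i) :
    (frameCoord N P.coords 0).eval t = 0 ∧ (frameCoord N P.coords 1).eval t = 0 := by
  obtain ⟨a, ha⟩ := Projectivization.exists_smul_eq_mk_rep K _ (P.eval_ne_zero t)
  have hrow : ∀ j, (a : K) * (frameCoord N P.coords j).eval t =
      (1 : Matrix (Fin 3) (Fin 3) K) j 2 := fun j => by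
    rw [← mul_eq_one_comm.1 hMN, Matrix.mul_apply, eval_frameCoord, Finset.mul_sum]
    refine Finset.sum_congr rfl fun k _ => ?_
    rw [hM, point, ← ha, mul_left_comm]
    rfl
  have h0 := hrow 0
  have h1 := hrow 1
  exact ⟨by simpa using h0, by simpa using h1⟩

theorem natDegree_lt_deg_of_coeff_eq_zero {f : K[X]} {d : ℕ} (hf : f ≠ 0) (hd : f.natDegree ≤ d)
    (h : f.coeff d = 0) : f.natDegree < d := by
  refine lt_of_le_of_ne hd fun he => hf ?_
  rw [← he] at h
  exact Polynomial.leadingCoeff_eq_zero.1 h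

/-- A proper polynomial parametrization that reaches its limit point does not lie on a line. -/
theorem linearIndependent_coords [IsAlgClosed K] (hP : P.IsProper) {t₀ : K}
    (ht₀ : P.point t₀ = P.limitPoint) : LinearIndependent K P.coords := by
  obtain ⟨M, N, hMN, hM⟩ := exists_matrix_with_column P.limitPoint.rep_nonzero
  obtain ⟨hc0, hc1, hc2⟩ := P.coeff_deg_frameCoord hMN hM
  obtain ⟨he0, he1⟩ := P.eval_frameCoord_of_point_eq hMN (t := t₀) (by rw [ht₀]; exact hM)
  have hd0 := P.natDegree_frameCoord_le N 0
  have hd1 := P.natDegree_frameCoord_le N 1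
  have hd2 := P.natDegree_frameCoord_le N 2
  have hsum := sum_frameCoord hMN P.coords
  generalize frameCoord N P.coords 0 = q₀ at *
  generalize frameCoord N P.coords 1 = q₁ at *
  generalize hq₂ : frameCoord N P.coords 2 = q₂ at *
  by_contra hdep
  rw [Fintype.not_linearIndependent_iff] at hdep
  obtain ⟨g, hg, i₀, hi₀⟩ := hdep
  have hrel : C (Matrix.vecMul g M 0) * q₀ + C (Matrix.vecMul g M 1) * q₁ +
      C (Matrix.vecMul g M 2) * q₂ = 0 := by
    rw [← hg]
    simp only [Fin.sum_univ_three, hsum, Matrix.vecMul, dotProduct, Polynomial.smul_eq_C_mul,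
      map_add, map_mul]
    ring
  -- Only q₂ has a term of degree d, so it cannot take part in the relation.
  have ha2 : Matrix.vecMul g M 2 = 0 := by
    have := congrArg (fun f => Polynomial.coeff f P.deg) hrel
    simp only [Polynomial.coeff_add, Polynomial.coeff_C_mul, hc0, hc1, Polynomial.coeff_zero] at this
    simpa [hc2] using this
  have hane : Matrix.vecMul g M 0 ≠ 0 ∨ Matrix.vecMul g M 1 ≠ 0 := by
    by_contra! hcon
    have hz : Matrix.vecMul g M = 0 := funext fun j => by
      match j with
      | 0 => exact hcon.1
      | 1 => exact hcon.2
      | 2 => exact ha2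
    have := Matrix.vecMul_vecMul g M N
    rw [hMN, Matrix.vecMul_one, hz, Matrix.zero_vecMul] at this
    exact hi₀ (congrFun this i₀).symm
  rw [ha2, map_zero, zero_mul, add_zero] at hrel
  generalize Matrix.vecMul g M 0 = a₀ at *
  generalize Matrix.vecMul g M 1 = a₁ at *
  -- The relation makes q₀ and q₁ multiples of one β, which vanishes at t₀ and has no term of degree
  -- d.
  obtain ⟨β, c₀, c₁, hβ0, hβ1, hβd, hβc, hβe⟩ : ∃ (β : K[X]) (c₀ c₁ : K), q₀ = C c₀ * β ∧
      q₁ = C c₁ * β ∧ β.natDegree ≤ P.deg ∧ β.coeff P.deg = 0 ∧ β.eval t₀ = 0 := by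
    by_cases h1 : a₁ = 0
    · have h0 : a₀ ≠ 0 := hane.resolve_right (not_not.2 h1)
      rw [h1, map_zero, zero_mul, add_zero, mul_eq_zero, C_eq_zero, or_iff_right h0] at hrel
      exact ⟨q₁, 0, 1, by simp [hrel], by simp, hd1, hc1, he1⟩
    · refine ⟨q₀, 1, -(a₀ / a₁), by simp, ?_, hd0, hc0, he0⟩
      have h2 : C a₁ * q₁ = C a₁ * (C (-(a₀ / a₁)) * q₀) := by
        rw [← mul_assoc, ← C_mul, mul_neg, mul_div_cancel₀ _ h1, map_neg]
        linear_combination hrel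
      exact mul_left_cancel₀ (C_ne_zero.2 h1) h2
  have hq0 : q₂ ≠ 0 := by
    rintro rfl
    simp at hc2
  have hq2d : q₂.natDegree = P.deg := le_antisymm hd2 (Polynomial.le_natDegree_of_ne_zero hc2)
  have hp : ∀ i, P.coords i = C (M i 0 * c₀ + M i 1 * c₁) * β + C (M i 2) * q₂ := fun i => by
    rw [hsum i, hβ0, hβ1, map_add, map_mul, map_mul]
    ring
  have hdeg := finrank_adjoin_div_add_natDegree (α := β) (g := 1) hq0 fun h =>
    ⟨fun h1 => ⟨h1.trans (one_dvd _), h1.trans (one_dvd _)⟩, fun ⟨h1, h2⟩ =>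
      (P.gcd_eq_one h fun i => by
        rw [hp]
        exact dvd_add (h1.mul_left _) (h2.mul_left _)).dvd⟩
  have hq0' : algebraMap K[X] (RatFunc K) q₂ ≠ 0 := by simpa using hq0
  have htop := hP.eq_top_of_div_mem
    K⟮algebraMap K[X] (RatFunc K) β / algebraMap K[X] (RatFunc K) q₂⟯ hq0' fun i => by
      have hC : ∀ r : K, algebraMap K[X] (RatFunc K) (C r) = algebraMap K (RatFunc K) r := fun r =>
        (IsScalarTower.algebraMap_apply K K[X] (RatFunc K) r).symm
      rw [hp, map_add, map_mul, map_mul, add_div, mul_div_assoc, mul_div_cancel_right₀ _ hq0',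
        hC, hC]
      exact add_mem (mul_mem (IntermediateField.algebraMap_mem _ _)
        (IntermediateField.mem_adjoin_simple_self K _)) (IntermediateField.algebraMap_mem _ _)
  -- The reduced fraction β/q₂ generates K(t), so d = 1. Then β is constant with a root, hence zero,
  -- and a root of q₂ is common to all coordinates.
  rw [IntermediateField.finrank_eq_one_iff_eq_top.2 htop, natDegree_one, add_zero, hq2d] at hdeg
  have hβz : β = 0 := by
    by_contra hne
    have h1 := natDegree_lt_deg_of_coeff_eq_zero hne hβd hβc
    obtain ⟨c, rfl⟩ := Polynomial.natDegree_eq_zero.1 (show β.natDegree = 0 by omega)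
    rw [eval_C] at hβe
    exact hne (by rw [hβe, map_zero])
  rw [hβz, natDegree_zero] at hdeg
  obtain ⟨t, ht⟩ := IsAlgClosed.exists_root q₂ fun h => by
    have : q₂.natDegree = 0 := Polynomial.natDegree_eq_of_degree_eq_some h
    omega
  refine P.eval_ne_zero t (funext fun i => ?_)
  rw [hp, hβz]
  simp [ht.eq_zero]

end PlaneParametrization

end

/-! ### The multiplicity formula -/

theorem mainTheorem4 {K : Type*} [Field K] [IsAlgClosed K] [CharZero K]
    (P : PlaneParametrization K) (hproper : P.IsProper) (hline : ¬ IsProjLine P.curve)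
    (hreached : ∃ t₀ : K, P.point t₀ = P.limitPoint) :
    IsSingularPoint P.curve P.limitPoint ∧
      1 ≤ P.visibleMultiplicity ∧ 1 ≤ P.hiddenMultiplicity ∧
      curveMultiplicity P.curve P.limitPoint =
        P.visibleMultiplicity + P.hiddenMultiplicity := by
  obtain ⟨t₀, ht₀⟩ := hreached
  have : Infinite K := IsAlgClosed.instInfinite
  have hind := P.linearIndependent_coords hproper ht₀
  obtain ⟨M, N, hMN, hM⟩ := exists_matrix_with_column P.limitPoint.rep_nonzero
  have hM' : (fun i => M i 2) = P.limitPoint.rep := funext hM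
  obtain ⟨hc0, hc1, -⟩ := P.coeff_deg_frameCoord hMN hM
  obtain ⟨he0, he1⟩ := P.eval_frameCoord_of_point_eq hMN (t := t₀) (by rw [ht₀]; exact hM)
  have hne0 : frameCoord N P.coords 0 ≠ 0 := fun h => by
    have := frameCoord_combination_eq_zero hMN hind (a := ![1, 0, 0]) (by simp [Fin.sum_univ_three, h])
    simpa using congrFun this 0
  have hne1 : frameCoord N P.coords 1 ≠ 0 := fun h => by
    have := frameCoord_combination_eq_zero hMN hind (a := ![0, 1, 0]) (by simp [Fin.sum_univ_three, h])
    simpa using congrFun this 1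
  have hlt0 := PlaneParametrization.natDegree_lt_deg_of_coeff_eq_zero hne0
    (P.natDegree_frameCoord_le N 0) hc0
  have hlt1 := PlaneParametrization.natDegree_lt_deg_of_coeff_eq_zero hne1
    (P.natDegree_frameCoord_le N 1) hc1
  have hhid := P.rootMultiplicity_fibreFunction_reversedCoords hMN hne0 hne1
  rw [hM'] at hhid
  change P.hiddenMultiplicity + _ = _ at hhid
  have hvis : 1 ≤ P.visibleMultiplicity := by
    have hdvd := (dvd_fibreFunction_iff hMN P.coords (X - C t₀)).2
      ⟨dvd_iff_isRoot.2 he0, dvd_iff_isRoot.2 he1⟩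
    have hne : fibreFunction P.coords (fun i => M i 2) ≠ 0 := fun h => by
      have := ((dvd_fibreFunction_iff hMN P.coords 0).1 (by rw [h])).1
      exact hne0 (zero_dvd_iff.1 this)
    have := Polynomial.natDegree_le_of_dvd hdvd hne
    rwa [natDegree_X_sub_C, hM'] at this
  have hmult : curveMultiplicity P.curve P.limitPoint =
      P.visibleMultiplicity + P.hiddenMultiplicity := by
    obtain ⟨F₀, hF₀, hspan₀⟩ := exists_form_ker_coneHom hind
    have hnonempty : {m : ℕ | ∃ F, IsDefiningForm P.curve F ∧
        orderAt F P.limitPoint = m}.Nonempty :=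
      ⟨_, F₀, ⟨hF₀, by rw [hspan₀, P.homogeneousIdeal_curve]⟩, rfl⟩
    -- A nonempty set attains its infimum, so it is enough to compute the order of this defining
    -- form.
    obtain ⟨F, ⟨⟨n, hF⟩, hspan⟩, hord⟩ := Nat.sInf_mem hnonempty
    change _ = curveMultiplicity P.curve P.limitPoint at hord
    rw [P.homogeneousIdeal_curve] at hspan
    have h0 : F ≠ 0 := by
      rintro rfl
      exact ker_coneHom_ne_bot hind (by rw [← hspan]; simp)
    have hker : ∀ k (G : MvPolynomial (Fin 3) K), G.IsHomogeneous k →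
        (MvPolynomial.aeval P.coords G = 0 ↔ F ∣ G) := fun k G hG => by
      rw [← Ideal.mem_span_singleton, hspan, RingHom.mem_ker, coneHom_of_isHomogeneous _ hG,
        mul_eq_zero, or_iff_right (pow_ne_zero _ X_ne_zero), C_eq_zero]
    have hroot := (hker n F hF).2 dvd_rfl
    have hdvd := fun k G hG => (hker k G hG).1
    have hn := P.degree_eq_deg hproper hind hF h0 hroot hdvd
    have key := P.natDegree_shiftAlong_add_natDegree hproper hind hF h0 hroot hdvd hMN
    have hsum := orderAt_add_natDegree_shiftAlong hF h0 P.limitPoint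
    rw [hM'] at key
    change _ + P.visibleMultiplicity = _ at key
    -- Order + T-degree = n = d, T-degree + deg H_L = max(deg q₀, deg q₁), and m_H + max(deg q₀, deg
    -- q₁) = d.
    omega
  have hhid1 : 1 ≤ P.hiddenMultiplicity := by omega
  refine ⟨⟨?_, by omega⟩, hvis, hhid1, hmult⟩
  rw [← ht₀]
  exact fun G hG => hG.2 _ ⟨t₀, rfl⟩
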